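/- For each $N\ge 1$ let $U$ be an $N\times N$ random unitary matrix distributed according to Haar measure (normalized to a probability measure) on the unitary group $\mathcal U(N)$. Fix $n\ge 1$, and for an $N\times N$ matrix $A$ with $N\ge n$ let $[A]_{i,j\le n}$ denote its top-left $n\times n$ block. Let $G_1,G_2,\ldots$ be independent random $n\times n$ matrices, each with i.i.d. standard complex Gaussian entries, i.e. entries with density $\pi^{-1}e^{-|z|^2}$ with respect to Lebesgue measure on $\mathbb C$. Then, as $N\to\infty$, $$\sqrt N\left([U]_{i,j\le n},\,[U^2]_{i,j\le n},\,[U^3]_{i,j\le n},\ldots\right)\ \stackrel{d}{\longrightarrow}\ (G_1,G_2,G_3,\ldots)$$ as random sequences of $n\times n$ complex matrices (with the product topology on the space of sequences). In particular, for every finite set $S$ of triples $(p,i,j)$ with $p\ge 1$ and $1\le i,j\le n$, the random vectors $\big(\sqrt N\,[U^p]_{i,j}\big)_{(p,i,j)\in S}$ converge jointly in distribution to $\big([G_p]_{i,j}\big)_{(p,i,j)\in S}$, a vector of independent standard complex Gaussians. -/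

import Mathlib

open MeasureTheory ProbabilityTheory Filter

/-- The unitary group `U(N)` carries its Borel σ-algebra (for the topology inherited from
`N × N` complex matrices). -/
noncomputable instance unitaryGroupMeasurableSpace (N : ℕ) :
    MeasurableSpace (Matrix.unitaryGroup (Fin N) ℂ) := borel _

instance unitaryGroupBorelSpace (N : ℕ) :
    BorelSpace (Matrix.unitaryGroup (Fin N) ℂ) := ⟨rfl⟩

/-- `U` is a random `N × N` unitary matrix whose law is Haar measure on `U(N)`. (Under a
probability measure `P` the law is a probability measure, which fixes the normalization.) -/
structure IsHaarDistributed {Ω : Type*} [MeasurableSpace Ω] {N : ℕ}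
    (U : Ω → Matrix.unitaryGroup (Fin N) ℂ) (P : Measure Ω) : Prop where
  aemeasurable : AEMeasurable U P
  isHaarMeasure : (P.map U).IsHaarMeasure

/-- The standard complex Gaussian distribution, with density `π⁻¹ exp (-|z|²)` with respect to
Lebesgue measure in the plane. -/
noncomputable def stdComplexGaussian : Measure ℂ :=
  volume.withDensity fun z ↦ ENNReal.ofReal (Real.pi⁻¹ * Real.exp (-‖z‖ ^ 2))

/-- The top-left `n × n` block of an `N × N` matrix, for `n ≤ N`. (For the finitely many `N < n`
it is set to zero; this has no influence on limits as `N → ∞`.) -/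
def topLeftBlock (n : ℕ) {N : ℕ} (A : Matrix (Fin N) (Fin N) ℂ) (i j : Fin n) : ℂ :=
  if h : n ≤ N then A (Fin.castLE h i) (Fin.castLE h j) else 0

/-- The `(i, j)` entry of `√N` times the top-left `n × n` block of `U ^ p`. -/
noncomputable def scaledPowerEntry (n : ℕ) {N : ℕ} (U : Matrix.unitaryGroup (Fin N) ℂ)
    (p : ℕ+) (i j : Fin n) : ℂ :=
  (Real.sqrt (N : ℝ) : ℂ) * topLeftBlock n ((U : Matrix (Fin N) (Fin N) ℂ) ^ (p : ℕ)) i j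

/-! The proof is Stein's method on the unitary group. Left invariance of Haar measure makes the
integral of any left derivative vanish (`integral_leftDeriv_eq_zero`). Differentiating `(U ^ p) a j
* g U` along the matrix unit `E_{ai}` and summing over `a` gives the Schwinger–Dyson equation
(`schwingerDyson`): a sum of terms `tr (U ^ m) * (U ^ (p - m)) i j * g U`, plus the derivative of
`g` along `U ^ p * E_{ji}`, has mean zero. The term `m = 0` carries the factor `tr 1 = N` and
dominates, because `tr (U ^ m)` with `m ≥ 1` is bounded in `L²` uniformly in `N`. That bound comes
from the same equation with a trace as test function, and taking an entry instead shows that entries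
of powers have size `N ^ (-1/2)`.

Now let `g = exp (i t ℓ)`, with `ℓ` a real linear combination of the scaled entries. In its
derivative almost every term still contains an entry of a positive power of `U` or `U*`, hence is
small. What survives is the full cancellation of `(U*) ^ p` against `U ^ p`, which occurs only for
the same power and the same entry. This is an approximate Gaussian Stein identity
(`exists_norm_integral_pow_mul_exp_sub_le`), and different entries and powers decouple.

Summed over the entries, it says that `φ t = E exp (i t ℓ)` satisfies `φ' = -(t/2) σ φ + O(N ^
(-1/2))` with `σ = ∑ ‖c s‖ ^ 2`, so `φ 1` tends to `exp (-σ/4)`, the Gaussian characteristic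
function. Lévy continuity yields the finite marginals, and convergence of these suffices in a
countable product. -/

open scoped Matrix.Norms.L2Operator Topology ComplexConjugate

/-! ### Calculus along left translations and integration by parts for Haar measure. -/

section LeftDerivative

variable {N : ℕ}

/-- The exponential of a skew-Hermitian matrix, as a unitary matrix. -/
noncomputable def skewExp (X : skewAdjoint (Matrix (Fin N) (Fin N) ℂ)) :
    Matrix.unitaryGroup (Fin N) ℂ :=
  ⟨NormedSpace.exp (X : Matrix (Fin N) (Fin N) ℂ),
    letI : NormedAlgebra ℚ (Matrix (Fin N) (Fin N) ℂ) := .restrictScalars ℚ ℂ _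
    NormedSpace.exp_mem_unitary_of_mem_skewAdjoint X.2⟩

lemma skewExp_zero : skewExp (0 : skewAdjoint (Matrix (Fin N) (Fin N) ℂ)) = 1 :=
  Subtype.ext NormedSpace.exp_zero

lemma skewExp_add_smul (X : skewAdjoint (Matrix (Fin N) (Fin N) ℂ)) (s t : ℝ) :
    skewExp ((s + t) • X) = skewExp (s • X) * skewExp (t • X) := by
  apply Subtype.ext
  simp only [skewExp, Submonoid.coe_mul, skewAdjoint.val_smul]
  rw [add_smul]
  exact Matrix.exp_add_of_commute _ _ (((Commute.refl _).smul_left _).smul_right _)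

lemma hasDerivAt_skewExp (X : skewAdjoint (Matrix (Fin N) (Fin N) ℂ)) :
    HasDerivAt (fun t : ℝ ↦ (skewExp (t • X) : Matrix (Fin N) (Fin N) ℂ)) X 0 := by
  have h := hasDerivAt_exp_smul_const (𝕂 := ℝ) (X : Matrix (Fin N) (Fin N) ℂ) 0
  rw [zero_smul, NormedSpace.exp_zero, one_mul] at h
  exact h

/-- `f'` is the complexified derivative of `f` along left translations: `f' U` is complex linear
and `f' U X` is the derivative of `t ↦ f (exp (t X) U)` at `0` for every skew-Hermitian `X`. -/
structure HasLeftDeriv {E : Type*} [NormedAddCommGroup E] [NormedSpace ℂ E]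
    (f : Matrix.unitaryGroup (Fin N) ℂ → E)
    (f' : Matrix.unitaryGroup (Fin N) ℂ → Matrix (Fin N) (Fin N) ℂ → E) : Prop where
  continuous : Continuous f
  continuous_deriv : ∀ X, Continuous fun U ↦ f' U X
  isLinearMap : ∀ U, IsLinearMap ℂ (f' U)
  hasDerivAt : ∀ U (X : skewAdjoint (Matrix (Fin N) (Fin N) ℂ)),
    HasDerivAt (fun t : ℝ ↦ f (skewExp (t • X) * U)) (f' U X) 0

/-- Compactness makes every continuous function integrable and every continuous derivative bounded,
so no integrability hypothesis is needed later. -/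
instance : CompactSpace (Matrix.unitaryGroup (Fin N) ℂ) := by
  have hc : IsCompact (Matrix.unitaryGroup (Fin N) ℂ : Set (Matrix (Fin N) (Fin N) ℂ)) := by
    have : FiniteDimensional ℂ (Matrix (Fin N) (Fin N) ℂ) := inferInstance
    have : ProperSpace (Matrix (Fin N) (Fin N) ℂ) := FiniteDimensional.proper ℂ _
    refine Metric.isCompact_of_isClosed_isBounded isClosed_unitary ?_
    refine (Metric.isBounded_closedBall (x := 0) (r := 1)).subset fun U hU ↦ ?_
    rw [mem_closedBall_zero_iff]
    rcases subsingleton_or_nontrivial (Matrix (Fin N) (Fin N) ℂ) with h | h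
    · simp [Subsingleton.elim U 0]
    · exact (CStarRing.norm_of_mem_unitary hU).le
  exact isCompact_iff_compactSpace.mp hc

namespace HasLeftDeriv

variable {E F : Type*} [NormedAddCommGroup E] [NormedSpace ℂ E]
  [NormedAddCommGroup F] [NormedSpace ℂ F]
  {f g : Matrix.unitaryGroup (Fin N) ℂ → E}
  {f' g' : Matrix.unitaryGroup (Fin N) ℂ → Matrix (Fin N) (Fin N) ℂ → E}

/-- The one-parameter group law moves the derivative from time `0` to time `t`, as domination under
the integral sign requires. -/
lemma hasDerivAt_at (hf : HasLeftDeriv f f') (U : Matrix.unitaryGroup (Fin N) ℂ)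
    (X : skewAdjoint (Matrix (Fin N) (Fin N) ℂ)) (t : ℝ) :
    HasDerivAt (fun t : ℝ ↦ f (skewExp (t • X) * U)) (f' (skewExp (t • X) * U) X) t := by
  have h := hf.hasDerivAt (skewExp (t • X) * U) X
  have h2 : HasDerivAt (fun s : ℝ ↦ s - t) 1 t := (hasDerivAt_id t).sub_const t
  have h3 := HasDerivAt.scomp_of_eq t h h2 (sub_self t).symm
  simp only [one_smul] at h3
  refine h3.congr_of_eventuallyEq (Eventually.of_forall fun s ↦ ?_)
  simp only [Function.comp]
  rw [← mul_assoc, ← skewExp_add_smul, sub_add_cancel]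

lemma clm_comp (hf : HasLeftDeriv f f') (L : E →L[ℂ] F) :
    HasLeftDeriv (fun U ↦ L (f U)) (fun U X ↦ L (f' U X)) where
  continuous := L.continuous.comp hf.continuous
  continuous_deriv X := L.continuous.comp (hf.continuous_deriv X)
  isLinearMap U := ⟨fun x y ↦ by rw [(hf.isLinearMap U).map_add, map_add],
    fun c x ↦ by rw [(hf.isLinearMap U).map_smul, map_smul]⟩
  hasDerivAt U X := (L.restrictScalars ℝ).hasFDerivAt.comp_hasDerivAt 0 (hf.hasDerivAt U X)

lemma add (hf : HasLeftDeriv f f') (hg : HasLeftDeriv g g') :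
    HasLeftDeriv (fun U ↦ f U + g U) (fun U X ↦ f' U X + g' U X) where
  continuous := hf.continuous.add hg.continuous
  continuous_deriv X := (hf.continuous_deriv X).add (hg.continuous_deriv X)
  isLinearMap U := ((hf.isLinearMap U).mk' + (hg.isLinearMap U).mk').isLinear
  hasDerivAt U X := (hf.hasDerivAt U X).add (hg.hasDerivAt U X)

lemma sum {ι : Type*} (s : Finset ι) {f : ι → Matrix.unitaryGroup (Fin N) ℂ → E}
    {f' : ι → Matrix.unitaryGroup (Fin N) ℂ → Matrix (Fin N) (Fin N) ℂ → E}
    (hf : ∀ i ∈ s, HasLeftDeriv (f i) (f' i)) :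
    HasLeftDeriv (fun U ↦ ∑ i ∈ s, f i U) (fun U X ↦ ∑ i ∈ s, f' i U X) where
  continuous := continuous_finsetSum _ fun i hi ↦ (hf i hi).continuous
  continuous_deriv X := continuous_finsetSum _ fun i hi ↦ (hf i hi).continuous_deriv X
  isLinearMap U := ⟨fun x y ↦ by
      rw [← Finset.sum_add_distrib]
      exact Finset.sum_congr rfl fun i hi ↦ ((hf i hi).isLinearMap U).map_add x y,
    fun c x ↦ by
      rw [Finset.smul_sum]
      exact Finset.sum_congr rfl fun i hi ↦ ((hf i hi).isLinearMap U).map_smul c x⟩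
  hasDerivAt U X := HasDerivAt.fun_sum fun i hi ↦ (hf i hi).hasDerivAt U X

section Algebra

variable {A : Type*} [NormedRing A] [NormedAlgebra ℂ A]
  {f g : Matrix.unitaryGroup (Fin N) ℂ → A}
  {f' g' : Matrix.unitaryGroup (Fin N) ℂ → Matrix (Fin N) (Fin N) ℂ → A}

lemma mul (hf : HasLeftDeriv f f') (hg : HasLeftDeriv g g') :
    HasLeftDeriv (fun U ↦ f U * g U) (fun U X ↦ f' U X * g U + f U * g' U X) where
  continuous := hf.continuous.mul hg.continuous
  continuous_deriv X := ((hf.continuous_deriv X).mul hg.continuous).add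
    (hf.continuous.mul (hg.continuous_deriv X))
  isLinearMap U := ⟨fun x y ↦ by
      rw [(hf.isLinearMap U).map_add, (hg.isLinearMap U).map_add, add_mul, mul_add]; abel,
    fun c x ↦ by
      rw [(hf.isLinearMap U).map_smul, (hg.isLinearMap U).map_smul, smul_add, smul_mul_assoc,
        mul_smul_comm]⟩
  hasDerivAt U X := by
    simpa [skewExp_zero] using (hf.hasDerivAt U X).fun_mul (hg.hasDerivAt U X)

lemma pow (hf : HasLeftDeriv f f') (p : ℕ) :
    HasLeftDeriv (fun U ↦ f U ^ p)
      (fun U X ↦ ∑ m ∈ Finset.range p, f U ^ m * f' U X * f U ^ (p - 1 - m)) := by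
  induction p with
  | zero => exact ⟨by simpa using continuous_const, by simpa using continuous_const,
      by intro U; constructor <;> simp, by intro U X; simpa using hasDerivAt_const _ _⟩
  | succ p ih =>
    convert ih.mul hf using 3 with U U X
    · exact pow_succ _ _
    · rw [Finset.sum_range_succ, Finset.sum_mul]
      simp only [add_tsub_cancel_right, tsub_self, pow_zero, mul_one]
      congr 1
      refine Finset.sum_congr rfl fun m hm ↦ ?_
      rw [mul_assoc _ _ (f U), ← pow_succ]
      congr 2
      have := Finset.mem_range.1 hm
      omega

end Algebra

lemma cexp {f : Matrix.unitaryGroup (Fin N) ℂ → ℂ}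
    {f' : Matrix.unitaryGroup (Fin N) ℂ → Matrix (Fin N) (Fin N) ℂ → ℂ}
    (hf : HasLeftDeriv f f') :
    HasLeftDeriv (fun U ↦ Complex.exp (f U)) (fun U X ↦ Complex.exp (f U) * f' U X) where
  continuous := Complex.continuous_exp.comp hf.continuous
  continuous_deriv X := (Complex.continuous_exp.comp hf.continuous).mul (hf.continuous_deriv X)
  isLinearMap U := ⟨fun x y ↦ by rw [(hf.isLinearMap U).map_add, mul_add],
    fun c x ↦ by rw [(hf.isLinearMap U).map_smul, mul_smul_comm]⟩
  hasDerivAt U X := by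
    simpa [skewExp_zero] using (hf.hasDerivAt U X).cexp

end HasLeftDeriv

lemma hasLeftDeriv_coe :
    HasLeftDeriv (fun U : Matrix.unitaryGroup (Fin N) ℂ ↦ (U : Matrix (Fin N) (Fin N) ℂ))
      (fun U X ↦ X * U) where
  continuous := continuous_subtype_val
  continuous_deriv X := continuous_const.mul continuous_subtype_val
  isLinearMap U := ⟨fun x y ↦ add_mul _ _ _, fun c x ↦ smul_mul_assoc _ _ _⟩
  hasDerivAt U X := by
    simpa using (hasDerivAt_skewExp X).mul_const (U : Matrix (Fin N) (Fin N) ℂ)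

/-- Differentiating `U*` gives `U* X*`, which is conjugate-linear in `X`. On skew-Hermitian `X` it
equals `-U* X`, and this form extends complex-linearly. -/
lemma hasLeftDeriv_star :
    HasLeftDeriv (fun U : Matrix.unitaryGroup (Fin N) ℂ ↦ star (U : Matrix (Fin N) (Fin N) ℂ))
      (fun U X ↦ -(star (U : Matrix (Fin N) (Fin N) ℂ) * X)) where
  continuous := continuous_subtype_val.star
  continuous_deriv X := (continuous_subtype_val.star.mul continuous_const).neg
  isLinearMap U := ⟨fun x y ↦ by rw [mul_add, neg_add], fun c x ↦ by rw [mul_smul_comm, smul_neg]⟩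
  hasDerivAt U X := by
    have h := (hasLeftDeriv_coe.hasDerivAt U X).star
    have hX : star (X : Matrix (Fin N) (Fin N) ℂ) = -X := X.2
    rw [star_mul, hX, mul_neg] at h
    exact h

lemma integrable_of_continuous_unitaryGroup {E : Type*} [NormedAddCommGroup E]
    {μ : Measure (Matrix.unitaryGroup (Fin N) ℂ)} [IsFiniteMeasure μ]
    {f : Matrix.unitaryGroup (Fin N) ℂ → E} (hf : Continuous f) : Integrable f μ :=
  hf.integrable_of_hasCompactSupport (HasCompactSupport.of_compactSpace _)

/-- For skew-Hermitian `X` the integral of `f (exp (t X) U)` does not depend on `t`. Complex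
linearity then reaches every matrix, in particular the matrix units. -/
lemma integral_leftDeriv_eq_zero {μ : Measure (Matrix.unitaryGroup (Fin N) ℂ)} [IsFiniteMeasure μ]
    [μ.IsMulLeftInvariant] {f : Matrix.unitaryGroup (Fin N) ℂ → ℂ}
    {f' : Matrix.unitaryGroup (Fin N) ℂ → Matrix (Fin N) (Fin N) ℂ → ℂ}
    (hf : HasLeftDeriv f f') (X : Matrix (Fin N) (Fin N) ℂ) :
    ∫ U, f' U X ∂μ = 0 := by
  have key : ∀ X : skewAdjoint (Matrix (Fin N) (Fin N) ℂ), ∫ U, f' U X ∂μ = 0 := by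
    intro X
    obtain ⟨C, hC⟩ := isCompact_univ.exists_bound_of_continuousOn
      (hf.continuous_deriv X).continuousOn
    have hd := hasDerivAt_integral_of_dominated_loc_of_deriv_le (μ := μ) (x₀ := (0 : ℝ))
      (s := Set.univ) (F := fun t U ↦ f (skewExp (t • X) * U))
      (F' := fun t U ↦ f' (skewExp (t • X) * U) X) (bound := fun _ ↦ C) univ_mem
      (Eventually.of_forall fun t ↦
        (integrable_of_continuous_unitaryGroup (hf.continuous.comp (continuous_const_mul _))).aestronglyMeasurable)
      (integrable_of_continuous_unitaryGroup (hf.continuous.comp (continuous_const_mul _)))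
      (integrable_of_continuous_unitaryGroup ((hf.continuous_deriv X).comp (continuous_const_mul _))).aestronglyMeasurable
      (Eventually.of_forall fun U t _ ↦ hC _ trivial) (integrable_const _)
      (Eventually.of_forall fun U t _ ↦ hf.hasDerivAt_at U X t)
    have hconst : (fun t : ℝ ↦ ∫ U, f (skewExp (t • X) * U) ∂μ) = fun _ ↦ ∫ U, f U ∂μ :=
      funext fun t ↦ integral_mul_left_eq_self f _
    have h0 := hd.2
    rw [hconst] at h0
    have := h0.unique (hasDerivAt_const _ _)
    simpa [skewExp_zero] using this
  have hA : (1 / 2 : ℂ) • (X - star X) ∈ skewAdjoint (Matrix (Fin N) (Fin N) ℂ) := by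
    rw [skewAdjoint.mem_iff, star_smul, star_sub, star_star, ← smul_neg, neg_sub]
    norm_num
  have hB : (-Complex.I / 2) • (X + star X) ∈ skewAdjoint (Matrix (Fin N) (Fin N) ℂ) := by
    rw [skewAdjoint.mem_iff, star_smul, star_add, star_star, ← neg_smul, add_comm X]
    congr 1
    simp [neg_div]
  -- Every matrix is `A + i B` with `A` and `B` skew-Hermitian.
  have hdec : X = (1 / 2 : ℂ) • (X - star X) +
      Complex.I • ((-Complex.I / 2) • (X + star X)) := by
    rw [smul_smul, show Complex.I * (-Complex.I / 2) = 1 / 2 by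
      rw [mul_div_assoc', mul_neg, Complex.I_mul_I, neg_neg], ← smul_add, sub_add_add_cancel,
      ← two_smul ℂ X, smul_smul]
    norm_num
  generalize (1 / 2 : ℂ) • (X - star X) = A at hA hdec
  generalize (-Complex.I / 2) • (X + star X) = B at hB hdec
  simp_rw [hdec, (hf.isLinearMap _).map_add, (hf.isLinearMap _).map_smul, smul_eq_mul]
  rw [integral_add (integrable_of_continuous_unitaryGroup (hf.continuous_deriv _)) ((integrable_of_continuous_unitaryGroup (hf.continuous_deriv _)).const_mul _),
    integral_const_mul, key ⟨_, hA⟩, key ⟨_, hB⟩, mul_zero, add_zero]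

end LeftDerivative

/-! ### The Schwinger–Dyson equation. -/

section SchwingerDyson

variable {N : ℕ}

/-- The `(i, j)` entry of a matrix as a continuous linear functional. -/
noncomputable def entryCLM (i j : Fin N) : Matrix (Fin N) (Fin N) ℂ →L[ℂ] ℂ :=
  LinearMap.toContinuousLinearMap (Matrix.entryLinearMap ℂ ℂ i j)

@[simp]
lemma entryCLM_apply (i j : Fin N) (A : Matrix (Fin N) (Fin N) ℂ) : entryCLM i j A = A i j := rfl

/-- The trace of a matrix as a continuous linear functional. -/
noncomputable def traceCLM : Matrix (Fin N) (Fin N) ℂ →L[ℂ] ℂ :=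
  LinearMap.toContinuousLinearMap (Matrix.traceLinearMap (Fin N) ℂ ℂ)

@[simp]
lemma traceCLM_apply (A : Matrix (Fin N) (Fin N) ℂ) : traceCLM A = A.trace := rfl

lemma mul_single_mul_apply (A B : Matrix (Fin N) (Fin N) ℂ) (a i k l : Fin N) :
    (A * Matrix.single a i (1 : ℂ) * B : Matrix (Fin N) (Fin N) ℂ) k l = A k a * B i l := by
  rw [Matrix.mul_assoc, Matrix.mul_apply, Finset.sum_eq_single a]
  · simp
  · intro b _ hb
    simp [hb]
  · simp

/-- The matrix unit splits each Leibniz term into `(U ^ m) a a * (U ^ (p - m)) i j`; the sum over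
`a` closes the first factor into a trace. -/
lemma sum_trace_mul_pow (U : Matrix (Fin N) (Fin N) ℂ) (p : ℕ) (i j : Fin N) :
    ∑ a, (∑ m ∈ Finset.range p, U ^ m * (Matrix.single a i (1 : ℂ) * U) * U ^ (p - 1 - m) :
        Matrix (Fin N) (Fin N) ℂ) a j =
      ∑ m ∈ Finset.range p, (U ^ m).trace * (U ^ (p - m)) i j := by
  simp_rw [Matrix.sum_apply]
  rw [Finset.sum_comm]
  refine Finset.sum_congr rfl fun m hm ↦ ?_
  have hm' : U * U ^ (p - 1 - m) = U ^ (p - m) := by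
    rw [← pow_succ']
    have := Finset.mem_range.1 hm
    congr 1
    omega
  simp_rw [← Matrix.mul_assoc, Matrix.mul_assoc _ U, hm', mul_single_mul_apply]
  rw [← Finset.sum_mul]
  rfl

lemma norm_pow_apply_le_one (U : Matrix.unitaryGroup (Fin N) ℂ) (p : ℕ) (i j : Fin N) :
    ‖((U : Matrix (Fin N) (Fin N) ℂ) ^ p) i j‖ ≤ 1 :=
  entry_norm_bound_of_unitary (pow_mem U.2 p) i j

lemma norm_trace_pow_le (U : Matrix.unitaryGroup (Fin N) ℂ) (p : ℕ) :
    ‖((U : Matrix (Fin N) (Fin N) ℂ) ^ p).trace‖ ≤ N := by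
  refine (norm_sum_le _ _).trans ((Finset.sum_le_sum fun i _ ↦
    norm_pow_apply_le_one U p i i).trans ?_)
  simp

lemma star_pow_mul_pow (U : Matrix.unitaryGroup (Fin N) ℂ) {p q : ℕ} (h : p ≤ q) :
    star (U : Matrix (Fin N) (Fin N) ℂ) ^ p * (U : Matrix (Fin N) (Fin N) ℂ) ^ q =
      (U : Matrix (Fin N) (Fin N) ℂ) ^ (q - p) := by
  have hU : star (U : Matrix (Fin N) (Fin N) ℂ) ^ p * (U : Matrix (Fin N) (Fin N) ℂ) ^ p = 1 := by
    rw [← star_pow]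
    exact Unitary.star_mul_self_of_mem (pow_mem U.2 p)
  obtain ⟨k, rfl⟩ := Nat.exists_eq_add_of_le h
  rw [pow_add, ← mul_assoc, hU, one_mul, Nat.add_sub_cancel_left]

lemma star_pow_mul_pow' (U : Matrix.unitaryGroup (Fin N) ℂ) {p q : ℕ} (h : p ≤ q) :
    star (U : Matrix (Fin N) (Fin N) ℂ) ^ q * (U : Matrix (Fin N) (Fin N) ℂ) ^ p =
      star (U : Matrix (Fin N) (Fin N) ℂ) ^ (q - p) := by
  have := congrArg star (star_pow_mul_pow U h)
  rwa [star_mul, star_pow, star_pow, star_pow, star_star] at this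

lemma star_pow_apply (U : Matrix (Fin N) (Fin N) ℂ) (p : ℕ) (i j : Fin N) :
    (star U ^ p) i j = conj ((U ^ p) j i) := by
  rw [← star_pow, Matrix.star_apply]
  rfl

lemma continuous_pow_apply (p : ℕ) (i j : Fin N) :
    Continuous fun U : Matrix.unitaryGroup (Fin N) ℂ ↦
      ((U : Matrix (Fin N) (Fin N) ℂ) ^ p) i j :=
  ((hasLeftDeriv_coe.pow p).clm_comp (entryCLM i j)).continuous

lemma continuous_trace_pow (p : ℕ) :
    Continuous fun U : Matrix.unitaryGroup (Fin N) ℂ ↦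
      ((U : Matrix (Fin N) (Fin N) ℂ) ^ p).trace :=
  ((hasLeftDeriv_coe.pow p).clm_comp traceCLM).continuous

/-- Integration by parts works for constant directions only. Linearity packs the `U`-weighted
constant directions `E_{ai}` into one direction depending on `U`. -/
lemma HasLeftDeriv.deriv_pow_mul_single {g : Matrix.unitaryGroup (Fin N) ℂ → ℂ}
    {g' : Matrix.unitaryGroup (Fin N) ℂ → Matrix (Fin N) (Fin N) ℂ → ℂ}
    (hg : HasLeftDeriv g g') (p : ℕ) (i j : Fin N) (U : Matrix.unitaryGroup (Fin N) ℂ) :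
    g' U ((U : Matrix (Fin N) (Fin N) ℂ) ^ p * Matrix.single j i (1 : ℂ)) =
      ∑ a, ((U : Matrix (Fin N) (Fin N) ℂ) ^ p) a j * g' U (Matrix.single a i 1) := by
  have hX : (U : Matrix (Fin N) (Fin N) ℂ) ^ p * Matrix.single j i (1 : ℂ) =
      ∑ a, ((U : Matrix (Fin N) (Fin N) ℂ) ^ p) a j • Matrix.single a i (1 : ℂ) := by
    ext k l
    have := mul_single_mul_apply ((U : Matrix (Fin N) (Fin N) ℂ) ^ p) 1 j i k l
    rw [mul_one] at this
    rw [this, Matrix.sum_apply, Finset.sum_eq_single k]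
    · simp [Matrix.one_apply, Matrix.single_apply]
    · intro b _ hb
      simp [hb]
    · simp
  rw [hX]
  have := map_sum (hg.isLinearMap U).mk' (fun a ↦
    ((U : Matrix (Fin N) (Fin N) ℂ) ^ p) a j • Matrix.single a i (1 : ℂ)) Finset.univ
  simp only [IsLinearMap.mk'_apply] at this
  rw [this]
  refine Finset.sum_congr rfl fun a _ ↦ ?_
  rw [(hg.isLinearMap U).map_smul, smul_eq_mul]

lemma HasLeftDeriv.continuous_deriv_pow_mul_single {g : Matrix.unitaryGroup (Fin N) ℂ → ℂ}
    {g' : Matrix.unitaryGroup (Fin N) ℂ → Matrix (Fin N) (Fin N) ℂ → ℂ}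
    (hg : HasLeftDeriv g g') (p : ℕ) (i j : Fin N) :
    Continuous fun U : Matrix.unitaryGroup (Fin N) ℂ ↦
      g' U ((U : Matrix (Fin N) (Fin N) ℂ) ^ p * Matrix.single j i (1 : ℂ)) := by
  simp_rw [hg.deriv_pow_mul_single]
  exact continuous_finsetSum _ fun a _ ↦ (continuous_pow_apply p a j).mul (hg.continuous_deriv _)

/-- Schwinger–Dyson equation for the entries of the powers of a Haar unitary matrix. -/
lemma schwingerDyson {μ : Measure (Matrix.unitaryGroup (Fin N) ℂ)} [IsFiniteMeasure μ]
    [μ.IsMulLeftInvariant] {g : Matrix.unitaryGroup (Fin N) ℂ → ℂ}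
    {g' : Matrix.unitaryGroup (Fin N) ℂ → Matrix (Fin N) (Fin N) ℂ → ℂ}
    (hg : HasLeftDeriv g g') (p : ℕ) (i j : Fin N) :
    ∫ U, ((∑ m ∈ Finset.range p, ((U : Matrix (Fin N) (Fin N) ℂ) ^ m).trace *
        ((U : Matrix (Fin N) (Fin N) ℂ) ^ (p - m)) i j) * g U +
      g' U ((U : Matrix (Fin N) (Fin N) ℂ) ^ p * Matrix.single j i (1 : ℂ))) ∂μ = 0 := by
  have hF := fun a : Fin N ↦ ((hasLeftDeriv_coe (N := N)).pow p |>.clm_comp (entryCLM a j)).mul hg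
  have h0 := fun a : Fin N ↦ integral_leftDeriv_eq_zero (μ := μ) (hF a) (Matrix.single a i 1)
  have hsum := integral_finsetSum (μ := μ) Finset.univ fun a _ ↦
    integrable_of_continuous_unitaryGroup (μ := μ) ((hF a).continuous_deriv (Matrix.single a i 1))
  rw [Finset.sum_eq_zero fun a _ ↦ h0 a] at hsum
  rw [← hsum]
  refine integral_congr_ae (Eventually.of_forall fun U ↦ ?_)
  simp only [entryCLM_apply]
  rw [Finset.sum_add_distrib, ← Finset.sum_mul, sum_trace_mul_pow, hg.deriv_pow_mul_single]

/-- The Schwinger–Dyson equation, with the leading term split off. -/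
lemma schwingerDyson_succ {μ : Measure (Matrix.unitaryGroup (Fin N) ℂ)} [IsFiniteMeasure μ]
    [μ.IsMulLeftInvariant] {g : Matrix.unitaryGroup (Fin N) ℂ → ℂ}
    {g' : Matrix.unitaryGroup (Fin N) ℂ → Matrix (Fin N) (Fin N) ℂ → ℂ}
    (hg : HasLeftDeriv g g') (k : ℕ) (i j : Fin N) :
    N * ∫ U : Matrix.unitaryGroup (Fin N) ℂ,
        ((U : Matrix (Fin N) (Fin N) ℂ) ^ (k + 1)) i j * g U ∂μ +
      ∫ U : Matrix.unitaryGroup (Fin N) ℂ,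
        (∑ m ∈ Finset.range k, ((U : Matrix (Fin N) (Fin N) ℂ) ^ (m + 1)).trace *
          ((U : Matrix (Fin N) (Fin N) ℂ) ^ (k - m)) i j) * g U ∂μ +
      ∫ U : Matrix.unitaryGroup (Fin N) ℂ,
        g' U ((U : Matrix (Fin N) (Fin N) ℂ) ^ (k + 1) * Matrix.single j i (1 : ℂ)) ∂μ = 0 := by
  rw [← integral_const_mul, ← integral_add, ← integral_add, ← schwingerDyson (μ := μ) hg (k + 1) i j]
  · refine integral_congr_ae (Eventually.of_forall fun U ↦ ?_)
    simp only
    -- The term `m = 0` supplies the factor `N`.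
    rw [Finset.sum_range_succ', pow_zero, Matrix.trace_one, Fintype.card_fin, Nat.sub_zero]
    simp_rw [Nat.add_sub_add_right]
    ring
  · refine integrable_of_continuous_unitaryGroup ?_
    exact (continuous_const.mul ((continuous_pow_apply _ i j).mul hg.continuous)).add
      ((continuous_finsetSum _ fun m _ ↦ (continuous_trace_pow _).mul
        (continuous_pow_apply _ i j)).mul hg.continuous)
  · exact integrable_of_continuous_unitaryGroup (hg.continuous_deriv_pow_mul_single _ i j)
  · exact integrable_of_continuous_unitaryGroup
      (continuous_const.mul ((continuous_pow_apply _ i j).mul hg.continuous))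
  · exact integrable_of_continuous_unitaryGroup
      ((continuous_finsetSum _ fun m _ ↦ (continuous_trace_pow _).mul
        (continuous_pow_apply _ i j)).mul hg.continuous)

end SchwingerDyson

/-! ### Uniform moment bounds for traces and entries of powers. -/

section Moments

variable {N : ℕ}

lemma star_pow_mul_neg_mul_star_pow (V A X : Matrix (Fin N) (Fin N) ℂ) {m q : ℕ} (hm : m < q) :
    V ^ m * -(V * (A * X)) * V ^ (q - 1 - m) = -(V ^ (m + 1) * A * X * V ^ (q - (m + 1))) := by
  rw [pow_succ, show q - 1 - m = q - (m + 1) by omega]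
  noncomm_ring

/-- The Schwinger–Dyson equation for `|tr U ^ p|²`. -/
lemma schwingerDyson_trace {μ : Measure (Matrix.unitaryGroup (Fin N) ℂ)} [IsProbabilityMeasure μ]
    [μ.IsMulLeftInvariant] (p : ℕ) :
    ∫ U : Matrix.unitaryGroup (Fin N) ℂ, (∑ m ∈ Finset.range p,
      ((U : Matrix (Fin N) (Fin N) ℂ) ^ m).trace * ((U : Matrix (Fin N) (Fin N) ℂ) ^ (p - m)).trace)
        * conj ((U : Matrix (Fin N) (Fin N) ℂ) ^ p).trace ∂μ = p * N := by
  -- The test function is `tr ((U*) ^ p)`, the conjugate of `tr (U ^ p)`. By cyclicity each of the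
  -- `p` terms of its derivative is `-tr E_{ii} = -1`; the sum over `i` produces `p * N`.
  have hg := (hasLeftDeriv_star (N := N)).pow p |>.clm_comp traceCLM
  have hval : ∀ (U : Matrix.unitaryGroup (Fin N) ℂ) (i : Fin N),
      traceCLM (∑ m ∈ Finset.range p, star (U : Matrix (Fin N) (Fin N) ℂ) ^ m *
        -(star (U : Matrix (Fin N) (Fin N) ℂ) *
          ((U : Matrix (Fin N) (Fin N) ℂ) ^ p * Matrix.single i i (1 : ℂ))) *
        star (U : Matrix (Fin N) (Fin N) ℂ) ^ (p - 1 - m)) = -p := by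
    intro U i
    rw [map_sum]
    have : ∀ m ∈ Finset.range p, traceCLM (star (U : Matrix (Fin N) (Fin N) ℂ) ^ m *
        -(star (U : Matrix (Fin N) (Fin N) ℂ) *
          ((U : Matrix (Fin N) (Fin N) ℂ) ^ p * Matrix.single i i (1 : ℂ))) *
        star (U : Matrix (Fin N) (Fin N) ℂ) ^ (p - 1 - m)) = -1 := by
      intro m hm
      have hm' := Finset.mem_range.1 hm
      rw [star_pow_mul_neg_mul_star_pow _ _ _ hm', traceCLM_apply, Matrix.trace_neg,
        Matrix.trace_mul_comm, ← mul_assoc, ← mul_assoc, ← pow_add,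
        show p - (m + 1) + (m + 1) = p by omega, star_pow_mul_pow _ le_rfl]
      simp
    rw [Finset.sum_congr rfl this]
    simp
  have hsd := fun i : Fin N ↦ schwingerDyson (μ := μ) hg p i i
  simp_rw [hval] at hsd
  have hc : ∀ i : Fin N, Continuous fun U : Matrix.unitaryGroup (Fin N) ℂ ↦
      (∑ m ∈ Finset.range p, ((U : Matrix (Fin N) (Fin N) ℂ) ^ m).trace *
        ((U : Matrix (Fin N) (Fin N) ℂ) ^ (p - m)) i i) *
        traceCLM (star (U : Matrix (Fin N) (Fin N) ℂ) ^ p) := fun i ↦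
    (continuous_finsetSum _ fun m _ ↦ (continuous_trace_pow m).mul
      (continuous_pow_apply _ i i)).mul hg.continuous
  have hsd' : ∀ i : Fin N, ∫ U : Matrix.unitaryGroup (Fin N) ℂ,
      (∑ m ∈ Finset.range p, ((U : Matrix (Fin N) (Fin N) ℂ) ^ m).trace *
        ((U : Matrix (Fin N) (Fin N) ℂ) ^ (p - m)) i i) *
        traceCLM (star (U : Matrix (Fin N) (Fin N) ℂ) ^ p) ∂μ = p := by
    intro i
    have := hsd i
    rw [integral_add (integrable_of_continuous_unitaryGroup (hc i)) (integrable_const _)] at this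
    simpa [add_neg_eq_zero] using this
  have hsum := integral_finsetSum (μ := μ) Finset.univ fun i _ ↦
    integrable_of_continuous_unitaryGroup (μ := μ) (hc i)
  rw [Finset.sum_congr rfl fun i _ ↦ hsd' i] at hsum
  simp only [Finset.sum_const, Finset.card_univ, Fintype.card_fin, nsmul_eq_mul] at hsum
  rw [mul_comm, ← hsum]
  refine integral_congr_ae (Eventually.of_forall fun U ↦ ?_)
  simp only
  rw [← Finset.sum_mul, Finset.sum_comm]
  congr 1
  · refine Finset.sum_congr rfl fun m _ ↦ ?_
    rw [← Finset.mul_sum]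
    rfl
  · rw [traceCLM_apply, ← star_pow, Matrix.star_eq_conjTranspose, Matrix.trace_conjTranspose]
    rfl

/-- The second moment of `tr U ^ p` is bounded uniformly in the dimension. -/
lemma exists_integral_norm_trace_pow_sq_le (p : ℕ) : ∃ C : ℝ, 1 ≤ p →
    ∀ (N : ℕ) (μ : Measure (Matrix.unitaryGroup (Fin N) ℂ)) [IsProbabilityMeasure μ]
      [μ.IsMulLeftInvariant], 1 ≤ N →
      ∫ U : Matrix.unitaryGroup (Fin N) ℂ, ‖((U : Matrix (Fin N) (Fin N) ℂ) ^ p).trace‖ ^ 2 ∂μ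
        ≤ C := by
  induction p using Nat.strong_induction_on with
  | _ p ih =>
  choose! C hC using ih
  -- With `x` the second moment and `S` the sum of the earlier bounds, the estimate below reads `x ≤
  -- p + (p/2) S + x/2`. The case `p = 0` must be excluded, since `tr 1 = N`.
  refine ⟨2 * p + p * ∑ m ∈ Finset.range (p - 1), C (m + 1), fun hp N μ _ _ hN ↦ ?_⟩
  have hN0 : (0 : ℝ) < N := by exact_mod_cast hN
  have hp0 : (0 : ℝ) < p := by exact_mod_cast hp
  obtain ⟨k, rfl⟩ : ∃ k, p = k + 1 := ⟨p - 1, by omega⟩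
  rw [Nat.add_sub_cancel]
  set T : ℕ → Matrix.unitaryGroup (Fin N) ℂ → ℂ := fun m U ↦
    ((U : Matrix (Fin N) (Fin N) ℂ) ^ m).trace with hT
  have hTc : ∀ m, Continuous (T m) := continuous_trace_pow
  have hTN : ∀ m U, ‖T m U‖ ≤ N := fun m U ↦ norm_trace_pow_le U m
  have hint : ∀ m, Integrable (fun U ↦ ‖T m U‖ ^ 2) μ := fun m ↦
    integrable_of_continuous_unitaryGroup ((hTc m).norm.pow 2)
  have hsd := schwingerDyson_trace (μ := μ) (k + 1)
  simp_rw [Finset.sum_range_succ', pow_zero, Matrix.trace_one, Fintype.card_fin, Nat.sub_zero,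
    add_mul] at hsd
  have hc1 : Continuous fun U ↦ (∑ m ∈ Finset.range k, T (m + 1) U * T (k + 1 - (m + 1)) U) *
      conj (T (k + 1) U) :=
    (continuous_finsetSum _ fun m _ ↦ (hTc _).mul (hTc _)).mul
      (Complex.continuous_conj.comp (hTc _))
  have hc2 : Continuous fun U ↦ (N : ℂ) * T (k + 1) U * conj (T (k + 1) U) :=
    (continuous_const.mul (hTc _)).mul (Complex.continuous_conj.comp (hTc _))
  change ∫ U, (∑ m ∈ Finset.range k, T (m + 1) U * T (k + 1 - (m + 1)) U) *
      conj (T (k + 1) U) + (N : ℂ) * T (k + 1) U * conj (T (k + 1) U) ∂μ = _ at hsd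
  rw [integral_add (integrable_of_continuous_unitaryGroup hc1)
    (integrable_of_continuous_unitaryGroup hc2)] at hsd
  have hsq : ∫ U, (N : ℂ) * T (k + 1) U * conj (T (k + 1) U) ∂μ =
      ((N * ∫ U, ‖T (k + 1) U‖ ^ 2 ∂μ : ℝ) : ℂ) := by
    rw [← integral_const_mul, ← integral_complex_ofReal]
    refine integral_congr_ae (Eventually.of_forall fun U ↦ ?_)
    simp only
    rw [mul_assoc, Complex.mul_conj, Complex.normSq_eq_norm_sq]
    push_cast
    rfl
  rw [hsq] at hsd
  have hle : (N : ℝ) * ∫ U, ‖T (k + 1) U‖ ^ 2 ∂μ ≤ (k + 1 : ℕ) * N +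
      ∫ U, ‖(∑ m ∈ Finset.range k, T (m + 1) U * T (k + 1 - (m + 1)) U) *
        conj (T (k + 1) U)‖ ∂μ := by
    have h1 := eq_sub_of_add_eq' hsd
    have h2 := congrArg norm h1
    rw [Complex.norm_real, Real.norm_of_nonneg (by positivity)] at h2
    rw [h2]
    refine (norm_sub_le _ _).trans (add_le_add ?_ (norm_integral_le_integral_norm _))
    rw [norm_mul, Complex.norm_natCast, Complex.norm_natCast]
  have hbd : ∫ U, ‖(∑ m ∈ Finset.range k, T (m + 1) U * T (k + 1 - (m + 1)) U) *
        conj (T (k + 1) U)‖ ∂μ ≤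
      ∫ U, (N : ℝ) * (((k + 1 : ℕ) / 2 : ℝ) * ∑ m ∈ Finset.range k, ‖T (m + 1) U‖ ^ 2 +
        (1 / 2 : ℝ) * ‖T (k + 1) U‖ ^ 2) ∂μ := by
    refine integral_mono (integrable_of_continuous_unitaryGroup hc1).norm
      ((((integrable_finsetSum _ fun m _ ↦ hint (m + 1)).const_mul _).add
        ((hint _).const_mul _)).const_mul _) fun U ↦ ?_
    simp only
    rw [norm_mul, RCLike.norm_conj]
    -- The trivial bound `N` on one trace is affordable: the leading term carries the same factor.
    have h1 : ‖∑ m ∈ Finset.range k, T (m + 1) U * T (k + 1 - (m + 1)) U‖ ≤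
        ∑ m ∈ Finset.range k, ‖T (m + 1) U‖ * N :=
      (norm_sum_le _ _).trans (Finset.sum_le_sum fun m _ ↦ by
        rw [norm_mul]; exact mul_le_mul_of_nonneg_left (hTN _ _) (norm_nonneg _))
    refine (mul_le_mul_of_nonneg_right h1 (norm_nonneg _)).trans ?_
    -- Young's inequality, weighted so that the `k` copies of `‖T (k + 1) U‖ ^ 2` add up to at most
    -- one half and can be absorbed on the left.
    have h2 : ∀ m ∈ Finset.range k, ‖T (m + 1) U‖ * ‖T (k + 1) U‖ ≤
        ((k + 1 : ℕ) / 2 : ℝ) * ‖T (m + 1) U‖ ^ 2 +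
          (1 / (2 * (k + 1 : ℕ)) : ℝ) * ‖T (k + 1) U‖ ^ 2 := by
      intro m _
      have : 0 ≤ ((k + 1 : ℕ) * ‖T (m + 1) U‖ - ‖T (k + 1) U‖) ^ 2 / (2 * (k + 1 : ℕ) : ℝ) := by
        positivity
      have e : ((k + 1 : ℕ) * ‖T (m + 1) U‖ - ‖T (k + 1) U‖) ^ 2 / (2 * (k + 1 : ℕ) : ℝ) =
        ((k + 1 : ℕ) / 2 : ℝ) * ‖T (m + 1) U‖ ^ 2 +
          (1 / (2 * (k + 1 : ℕ)) : ℝ) * ‖T (k + 1) U‖ ^ 2 - ‖T (m + 1) U‖ * ‖T (k + 1) U‖ := by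
        field_simp
        ring
      linarith
    have h3 := Finset.sum_le_sum h2
    rw [Finset.sum_add_distrib, ← Finset.mul_sum, ← Finset.sum_mul, Finset.sum_const,
      Finset.card_range, nsmul_eq_mul] at h3
    have h4 : (k : ℝ) * ((1 / (2 * (k + 1 : ℕ)) : ℝ) * ‖T (k + 1) U‖ ^ 2) ≤
        (1 / 2 : ℝ) * ‖T (k + 1) U‖ ^ 2 := by
      rw [← mul_assoc]
      refine mul_le_mul_of_nonneg_right ?_ (by positivity)
      rw [mul_one_div, div_le_iff₀ (by positivity)]
      push_cast
      linarith
    calc _ = (N : ℝ) * ((∑ m ∈ Finset.range k, ‖T (m + 1) U‖) * ‖T (k + 1) U‖) := by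
          rw [← Finset.sum_mul]; ring
      _ ≤ _ := mul_le_mul_of_nonneg_left (by linarith) hN0.le
  rw [integral_const_mul, integral_add ((integrable_finsetSum _ fun m _ ↦
    hint (m + 1)).const_mul _) ((hint _).const_mul _), integral_const_mul, integral_const_mul,
    integral_finsetSum _ fun m _ ↦ hint (m + 1)] at hbd
  have hS : ∑ m ∈ Finset.range k, ∫ U, ‖T (m + 1) U‖ ^ 2 ∂μ ≤
      ∑ m ∈ Finset.range k, C (m + 1) := by
    refine Finset.sum_le_sum fun m hm ↦ ?_
    have := Finset.mem_range.1 hm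
    exact hC (m + 1) (by omega) (by omega) N μ hN
  have hfin : (N : ℝ) * ∫ U, ‖T (k + 1) U‖ ^ 2 ∂μ ≤ N * ((k + 1 : ℕ) +
      (((k + 1 : ℕ) / 2 : ℝ) * ∑ m ∈ Finset.range k, C (m + 1) +
        (1 / 2 : ℝ) * ∫ U, ‖T (k + 1) U‖ ^ 2 ∂μ)) := by
    have := mul_le_mul_of_nonneg_left hS (show (0 : ℝ) ≤ N * ((k + 1 : ℕ) / 2 : ℝ) by positivity)
    linarith
  have := le_of_mul_le_mul_left hfin hN0
  linarith

lemma exists_integral_norm_trace_pow_le (p : ℕ) : ∃ C : ℝ, 1 ≤ p →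
    ∀ (N : ℕ) (μ : Measure (Matrix.unitaryGroup (Fin N) ℂ)) [IsProbabilityMeasure μ]
      [μ.IsMulLeftInvariant], 1 ≤ N →
      ∫ U : Matrix.unitaryGroup (Fin N) ℂ, ‖((U : Matrix (Fin N) (Fin N) ℂ) ^ p).trace‖ ∂μ
        ≤ C := by
  obtain ⟨C, hC⟩ := exists_integral_norm_trace_pow_sq_le p
  refine ⟨1 + C, fun hp N μ _ _ hN ↦ ?_⟩
  have hint : Integrable (fun U : Matrix.unitaryGroup (Fin N) ℂ ↦
      ‖((U : Matrix (Fin N) (Fin N) ℂ) ^ p).trace‖ ^ 2) μ :=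
    integrable_of_continuous_unitaryGroup ((continuous_trace_pow p).norm.pow 2)
  have h := integral_mono
    (integrable_of_continuous_unitaryGroup (μ := μ) (continuous_trace_pow p).norm)
    ((integrable_const (1 : ℝ)).add hint) fun U ↦ (by
      simp only [Pi.add_apply]
      nlinarith [sq_nonneg (‖((U : Matrix (Fin N) (Fin N) ℂ) ^ p).trace‖ - 1)])
  simp only [Pi.add_apply] at h
  rw [integral_add (integrable_const _) hint] at h
  simp only [integral_const, probReal_univ, smul_eq_mul, mul_one] at h
  linarith [hC hp N μ hN]

/-- The subleading terms of the Schwinger–Dyson equation are bounded uniformly in the dimension. -/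
lemma exists_norm_integral_trace_mul_pow_le (k : ℕ) : ∃ C : ℝ,
    ∀ (N : ℕ) (μ : Measure (Matrix.unitaryGroup (Fin N) ℂ)) [IsProbabilityMeasure μ]
      [μ.IsMulLeftInvariant], 1 ≤ N → ∀ (i j : Fin N) (g : Matrix.unitaryGroup (Fin N) ℂ → ℂ),
      Continuous g → (∀ U, ‖g U‖ ≤ 1) →
      ‖∫ U : Matrix.unitaryGroup (Fin N) ℂ,
        (∑ m ∈ Finset.range k, ((U : Matrix (Fin N) (Fin N) ℂ) ^ (m + 1)).trace *
          ((U : Matrix (Fin N) (Fin N) ℂ) ^ (k - m)) i j) * g U ∂μ‖ ≤ C := by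
  choose C hC using exists_integral_norm_trace_pow_le
  refine ⟨∑ m ∈ Finset.range k, C (m + 1), fun N μ _ _ hN i j g hgc hg ↦ ?_⟩
  have hint : ∀ m, Integrable (fun U : Matrix.unitaryGroup (Fin N) ℂ ↦
      ‖((U : Matrix (Fin N) (Fin N) ℂ) ^ (m + 1)).trace‖) μ := fun m ↦
    integrable_of_continuous_unitaryGroup (continuous_trace_pow _).norm
  calc _ ≤ ∫ U : Matrix.unitaryGroup (Fin N) ℂ,
        ∑ m ∈ Finset.range k, ‖((U : Matrix (Fin N) (Fin N) ℂ) ^ (m + 1)).trace‖ ∂μ := by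
        refine norm_integral_le_of_norm_le (integrable_finsetSum _ fun m _ ↦ hint m)
          (Eventually.of_forall fun U ↦ ?_)
        rw [norm_mul]
        refine (mul_le_of_le_one_right (norm_nonneg _) (hg U)).trans
          ((norm_sum_le _ _).trans (Finset.sum_le_sum fun m _ ↦ ?_))
        rw [norm_mul]
        exact mul_le_of_le_one_right (norm_nonneg _) (norm_pow_apply_le_one _ _ _ _)
    _ ≤ _ := by
        rw [integral_finsetSum _ fun m _ ↦ hint m]
        exact Finset.sum_le_sum fun m _ ↦ hC (m + 1) (by omega) N μ hN

/-- The entries of `U ^ p` have second moment of order `1 / N`. -/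
lemma exists_integral_norm_pow_apply_sq_le (k : ℕ) : ∃ C : ℝ,
    ∀ (N : ℕ) (μ : Measure (Matrix.unitaryGroup (Fin N) ℂ)) [IsProbabilityMeasure μ]
      [μ.IsMulLeftInvariant], 1 ≤ N → ∀ i j : Fin N,
      N * ∫ U : Matrix.unitaryGroup (Fin N) ℂ,
        ‖((U : Matrix (Fin N) (Fin N) ℂ) ^ (k + 1)) i j‖ ^ 2 ∂μ ≤ C := by
  obtain ⟨C, hC⟩ := exists_norm_integral_trace_mul_pow_le k
  refine ⟨C + (k + 1 : ℕ), fun N μ _ _ hN i j ↦ ?_⟩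
  -- Testing against the conjugate entry turns the leading term into the second moment. The
  -- derivative is a sum of `k + 1` products of entries of unitary matrices, hence at most `k + 1`
  -- in norm.
  have hg := (hasLeftDeriv_star (N := N)).pow (k + 1) |>.clm_comp (entryCLM j i)
  have hval : ∀ U : Matrix.unitaryGroup (Fin N) ℂ,
      ‖entryCLM j i (∑ m ∈ Finset.range (k + 1), star (U : Matrix (Fin N) (Fin N) ℂ) ^ m *
        -(star (U : Matrix (Fin N) (Fin N) ℂ) *
          ((U : Matrix (Fin N) (Fin N) ℂ) ^ (k + 1) * Matrix.single j i (1 : ℂ))) *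
        star (U : Matrix (Fin N) (Fin N) ℂ) ^ (k + 1 - 1 - m))‖ ≤ (k + 1 : ℕ) := by
    intro U
    rw [map_sum]
    refine (norm_sum_le _ _).trans ((Finset.sum_le_sum (g := fun _ ↦ (1 : ℝ))
      fun m hm ↦ ?_).trans (by simp))
    have hm' := Finset.mem_range.1 hm
    rw [star_pow_mul_neg_mul_star_pow _ _ _ hm', star_pow_mul_pow _ hm', entryCLM_apply,
      Matrix.neg_apply, norm_neg, mul_single_mul_apply, norm_mul, star_pow_apply, RCLike.norm_conj]
    exact mul_le_one₀ (norm_pow_apply_le_one _ _ _ _) (norm_nonneg _)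
      (norm_pow_apply_le_one _ _ _ _)
  have hsd := schwingerDyson_succ (μ := μ) hg k i j
  have hsub := hC N μ hN i j _ hg.continuous fun U ↦ by
    rw [entryCLM_apply, star_pow_apply, RCLike.norm_conj]
    exact norm_pow_apply_le_one _ _ _ _
  have hder := norm_integral_le_of_norm_le_const (μ := μ) (Eventually.of_forall hval)
  rw [probReal_univ, mul_one] at hder
  have hmain : ∫ U : Matrix.unitaryGroup (Fin N) ℂ,
      ((U : Matrix (Fin N) (Fin N) ℂ) ^ (k + 1)) i j *
        entryCLM j i (star (U : Matrix (Fin N) (Fin N) ℂ) ^ (k + 1)) ∂μ =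
      ((∫ U : Matrix.unitaryGroup (Fin N) ℂ,
        ‖((U : Matrix (Fin N) (Fin N) ℂ) ^ (k + 1)) i j‖ ^ 2 ∂μ : ℝ) : ℂ) := by
    rw [← integral_complex_ofReal]
    refine integral_congr_ae (Eventually.of_forall fun U ↦ ?_)
    simp only
    rw [entryCLM_apply, star_pow_apply, Complex.mul_conj, Complex.normSq_eq_norm_sq]
  rw [hmain, add_assoc, add_eq_zero_iff_eq_neg] at hsd
  have h2 := congrArg norm hsd
  rw [← Complex.ofReal_natCast, ← Complex.ofReal_mul, Complex.norm_real,
    Real.norm_of_nonneg (by positivity), norm_neg] at h2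
  rw [h2]
  exact (norm_add_le _ _).trans (add_le_add hsub hder)

/-- The entries of `U ^ p` have first absolute moment of order `1 / √N`. -/
lemma exists_integral_norm_pow_apply_le (k : ℕ) : ∃ C : ℝ,
    ∀ (N : ℕ) (μ : Measure (Matrix.unitaryGroup (Fin N) ℂ)) [IsProbabilityMeasure μ]
      [μ.IsMulLeftInvariant], 1 ≤ N → ∀ i j : Fin N,
      ∫ U : Matrix.unitaryGroup (Fin N) ℂ,
        ‖((U : Matrix (Fin N) (Fin N) ℂ) ^ (k + 1)) i j‖ ∂μ ≤ C / √N := by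
  obtain ⟨C, hC⟩ := exists_integral_norm_pow_apply_sq_le k
  refine ⟨C + 1, fun N μ _ _ hN i j ↦ ?_⟩
  have hN0 : (0 : ℝ) < √N := Real.sqrt_pos.2 (by exact_mod_cast hN)
  have hNN : √(N : ℝ) * √N = N := Real.mul_self_sqrt (by positivity)
  have hint : Integrable (fun U : Matrix.unitaryGroup (Fin N) ℂ ↦
      N * ‖((U : Matrix (Fin N) (Fin N) ℂ) ^ (k + 1)) i j‖ ^ 2) μ :=
    integrable_of_continuous_unitaryGroup
      (continuous_const.mul ((continuous_pow_apply _ i j).norm.pow 2))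
  -- Pointwise `√N x ≤ N x ^ 2 + 1`, which accounts for the constant `C + 1`.
  have h := integral_mono
    ((integrable_of_continuous_unitaryGroup (μ := μ)
      (continuous_pow_apply (k + 1) i j).norm).const_mul (√(N : ℝ)))
    (hint.add (integrable_const (1 : ℝ))) fun U ↦ (by
      simp only [Pi.add_apply]
      have h := sq_nonneg (√N * ‖((U : Matrix (Fin N) (Fin N) ℂ) ^ (k + 1)) i j‖ - 1)
      rw [sub_sq, mul_pow, Real.sq_sqrt (by positivity)] at h
      have h0 : 0 ≤ √N * ‖((U : Matrix (Fin N) (Fin N) ℂ) ^ (k + 1)) i j‖ := by positivity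
      linarith)
  simp only [Pi.add_apply] at h
  rw [integral_const_mul, integral_add hint (integrable_const _), integral_const_mul] at h
  simp only [integral_const, probReal_univ, smul_eq_mul, mul_one] at h
  rw [le_div_iff₀ hN0, mul_comm]
  linarith [hC N μ hN i j]

end Moments

/-! ### The perturbed Gaussian differential equation and the derivative estimates. -/

section Stein

/-- Integrating factor `exp ((t ^ 2 - 1) σ / 4)`: it is at most `1` on the unit interval and equals
`1` at `t = 1`, so the mean value inequality loses no constant. -/
lemma norm_sub_exp_le_of_norm_deriv_add_le {φ φ' : ℝ → ℂ} {σ ε : ℝ} (hσ : 0 ≤ σ)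
    (hφ : ∀ t, HasDerivAt φ (φ' t) t) (h0 : φ 0 = 1)
    (h : ∀ t ∈ Set.Icc (0 : ℝ) 1, ‖φ' t + (t / 2 * σ : ℝ) * φ t‖ ≤ ε) :
    ‖φ 1 - (Real.exp (-σ / 4) : ℝ)‖ ≤ ε := by
  have hε : 0 ≤ ε := (norm_nonneg _).trans (h 0 (by simp))
  have hd : ∀ t : ℝ, HasDerivAt (fun t : ℝ ↦ ((Real.exp ((t ^ 2 - 1) * (σ / 4)) : ℝ) : ℂ) * φ t)
      (((Real.exp ((t ^ 2 - 1) * (σ / 4)) : ℝ) : ℂ) * (φ' t + (t / 2 * σ : ℝ) * φ t)) t := by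
    intro t
    have h1 : HasDerivAt (fun t : ℝ ↦ Real.exp ((t ^ 2 - 1) * (σ / 4)))
        (Real.exp ((t ^ 2 - 1) * (σ / 4)) * (2 * t * (σ / 4))) t := by
      have := (((hasDerivAt_pow 2 t).sub_const 1).mul_const (σ / 4)).exp
      simpa using this
    have h2 := h1.ofReal_comp.fun_mul (hφ t)
    refine h2.congr_deriv ?_
    push_cast
    ring
  have hb := norm_image_sub_le_of_norm_deriv_le_segment_01' (C := ε)
    (fun t _ ↦ (hd t).hasDerivWithinAt) fun t ht ↦ by
      rw [norm_mul, Complex.norm_real, Real.norm_of_nonneg (Real.exp_nonneg _)]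
      refine (mul_le_of_le_one_left (norm_nonneg _) (Real.exp_le_one_iff.2 ?_)).trans
        (h t ⟨ht.1, ht.2.le⟩)
      exact mul_nonpos_of_nonpos_of_nonneg (by nlinarith [ht.1, ht.2]) (by positivity)
  simpa [h0, neg_div] using hb

variable {N : ℕ}

/-- Each Leibniz term is `(U ^ (m + p + 1)) k j` times an entry bounded by `1`. Powers of `U` never
cancel each other, so the holomorphic part of the derivative has no main term. -/
lemma exists_integral_norm_deriv_pow_le (p q : ℕ) : ∃ C : ℝ,
    ∀ (N : ℕ) (μ : Measure (Matrix.unitaryGroup (Fin N) ℂ)) [IsProbabilityMeasure μ]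
      [μ.IsMulLeftInvariant], 1 ≤ N → ∀ i j k l : Fin N,
      ∫ U : Matrix.unitaryGroup (Fin N) ℂ,
        ‖entryCLM k l (∑ m ∈ Finset.range (q + 1), (U : Matrix (Fin N) (Fin N) ℂ) ^ m *
          ((U : Matrix (Fin N) (Fin N) ℂ) ^ (p + 1) * Matrix.single j i (1 : ℂ) * U) *
          (U : Matrix (Fin N) (Fin N) ℂ) ^ (q + 1 - 1 - m))‖ ∂μ ≤ C / √N := by
  choose C hC using exists_integral_norm_pow_apply_le
  refine ⟨∑ m ∈ Finset.range (q + 1), C (m + p), fun N μ _ _ hN i j k l ↦ ?_⟩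
  have hint : ∀ m, Integrable (fun U : Matrix.unitaryGroup (Fin N) ℂ ↦
      ‖((U : Matrix (Fin N) (Fin N) ℂ) ^ (m + p + 1)) k j‖) μ := fun m ↦
    integrable_of_continuous_unitaryGroup (continuous_pow_apply _ _ _).norm
  have hpt : ∀ U : Matrix.unitaryGroup (Fin N) ℂ,
      ‖entryCLM k l (∑ m ∈ Finset.range (q + 1), (U : Matrix (Fin N) (Fin N) ℂ) ^ m *
          ((U : Matrix (Fin N) (Fin N) ℂ) ^ (p + 1) * Matrix.single j i (1 : ℂ) * U) *
          (U : Matrix (Fin N) (Fin N) ℂ) ^ (q + 1 - 1 - m))‖ ≤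
        ∑ m ∈ Finset.range (q + 1), ‖((U : Matrix (Fin N) (Fin N) ℂ) ^ (m + p + 1)) k j‖ := by
    intro U
    rw [map_sum]
    refine (norm_sum_le _ _).trans (Finset.sum_le_sum fun m _ ↦ ?_)
    rw [← mul_assoc, ← mul_assoc, ← pow_add, mul_assoc, ← pow_succ', entryCLM_apply,
      mul_single_mul_apply, norm_mul, add_assoc]
    exact mul_le_of_le_one_right (norm_nonneg _) (norm_pow_apply_le_one _ _ _ _)
  refine (integral_mono_of_nonneg (Eventually.of_forall fun U ↦ norm_nonneg _)
    (integrable_finsetSum _ fun m _ ↦ hint m) (Eventually.of_forall hpt)).trans ?_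
  rw [integral_finsetSum _ fun m _ ↦ hint m, Finset.sum_div]
  exact Finset.sum_le_sum fun m _ ↦ hC (m + p) N μ hN k j

/-- The product collapses to a positive power of `U`, the identity, or a positive power of `U*`;
only the identity has entries that are not small. -/
lemma exists_integral_norm_star_pow_mul_pow_le (p q : ℕ) : ∃ C : ℝ,
    ∀ (N : ℕ) (μ : Measure (Matrix.unitaryGroup (Fin N) ℂ)) [IsProbabilityMeasure μ]
      [μ.IsMulLeftInvariant], 1 ≤ N → ∀ j l : Fin N,
      ∫ U : Matrix.unitaryGroup (Fin N) ℂ,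
        ‖(star (U : Matrix (Fin N) (Fin N) ℂ) ^ (q + 1) *
          (U : Matrix (Fin N) (Fin N) ℂ) ^ (p + 1)) l j - if q = p ∧ l = j then 1 else 0‖ ∂μ
        ≤ C / √N := by
  rcases lt_trichotomy q p with h | h | h
  · obtain ⟨C, hC⟩ := exists_integral_norm_pow_apply_le (p - q - 1)
    refine ⟨C, fun N μ _ _ hN j l ↦ ?_⟩
    simp only [h.ne, false_and, if_false, sub_zero]
    simp_rw [star_pow_mul_pow _ (Nat.add_le_add_right h.le 1),
      show p + 1 - (q + 1) = p - q - 1 + 1 by omega]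
    exact hC N μ hN l j
  · refine ⟨0, fun N μ _ _ hN j l ↦ ?_⟩
    subst h
    simp_rw [star_pow_mul_pow _ le_rfl]
    simp [Matrix.one_apply]
  · obtain ⟨C, hC⟩ := exists_integral_norm_pow_apply_le (q - p - 1)
    refine ⟨C, fun N μ _ _ hN j l ↦ ?_⟩
    simp only [h.ne', false_and, if_false, sub_zero]
    simp_rw [star_pow_mul_pow' _ (Nat.add_le_add_right h.le 1), star_pow_apply, RCLike.norm_conj,
      show q + 1 - (p + 1) = q - p - 1 + 1 by omega]
    exact hC N μ hN j l

/-- The source of the Gaussian covariance. Terms with `m < q` keep an entry of `(U*) ^ (q - m)` and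
are small; the last one is `-((U*) ^ (q + 1) * U ^ (p + 1)) l j` when `k = i` and zero otherwise. -/
lemma exists_integral_norm_deriv_star_pow_le (p q : ℕ) : ∃ C : ℝ,
    ∀ (N : ℕ) (μ : Measure (Matrix.unitaryGroup (Fin N) ℂ)) [IsProbabilityMeasure μ]
      [μ.IsMulLeftInvariant], 1 ≤ N → ∀ i j k l : Fin N,
      ∫ U : Matrix.unitaryGroup (Fin N) ℂ,
        ‖entryCLM l k (∑ m ∈ Finset.range (q + 1), star (U : Matrix (Fin N) (Fin N) ℂ) ^ m *
          -(star (U : Matrix (Fin N) (Fin N) ℂ) *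
            ((U : Matrix (Fin N) (Fin N) ℂ) ^ (p + 1) * Matrix.single j i (1 : ℂ))) *
          star (U : Matrix (Fin N) (Fin N) ℂ) ^ (q + 1 - 1 - m)) +
          if q = p ∧ k = i ∧ l = j then 1 else 0‖ ∂μ ≤ C / √N := by
  choose C hC using exists_integral_norm_pow_apply_le
  obtain ⟨C₀, hC₀⟩ := exists_integral_norm_star_pow_mul_pow_le p q
  -- `C r` controls the power `r + 1`, hence the shifted index for the power `q - m`.
  refine ⟨(∑ m ∈ Finset.range q, C (q - (m + 1))) + C₀, fun N μ _ _ hN i j k l ↦ ?_⟩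
  have hint : ∀ m, Integrable (fun U : Matrix.unitaryGroup (Fin N) ℂ ↦
      ‖((U : Matrix (Fin N) (Fin N) ℂ) ^ m) k i‖) μ := fun m ↦
    integrable_of_continuous_unitaryGroup (continuous_pow_apply _ _ _).norm
  have hint₀ : Integrable (fun U : Matrix.unitaryGroup (Fin N) ℂ ↦
      ‖(star (U : Matrix (Fin N) (Fin N) ℂ) ^ (q + 1) *
          (U : Matrix (Fin N) (Fin N) ℂ) ^ (p + 1)) l j - if q = p ∧ l = j then 1 else 0‖) μ :=
    integrable_of_continuous_unitaryGroup ((((hasLeftDeriv_star.pow (q + 1)).mul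
      (hasLeftDeriv_coe.pow (p + 1))).clm_comp (entryCLM l j)).continuous.sub
      continuous_const).norm
  have hpt : ∀ U : Matrix.unitaryGroup (Fin N) ℂ,
      ‖entryCLM l k (∑ m ∈ Finset.range (q + 1), star (U : Matrix (Fin N) (Fin N) ℂ) ^ m *
          -(star (U : Matrix (Fin N) (Fin N) ℂ) *
            ((U : Matrix (Fin N) (Fin N) ℂ) ^ (p + 1) * Matrix.single j i (1 : ℂ))) *
          star (U : Matrix (Fin N) (Fin N) ℂ) ^ (q + 1 - 1 - m)) +
          if q = p ∧ k = i ∧ l = j then 1 else 0‖ ≤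
        ∑ m ∈ Finset.range q, ‖((U : Matrix (Fin N) (Fin N) ℂ) ^ (q - m)) k i‖ +
        ‖(star (U : Matrix (Fin N) (Fin N) ℂ) ^ (q + 1) *
          (U : Matrix (Fin N) (Fin N) ℂ) ^ (p + 1)) l j - if q = p ∧ l = j then 1 else 0‖ := by
    intro U
    rw [Finset.sum_range_succ, map_add, map_sum, add_assoc]
    refine (norm_add_le _ _).trans (add_le_add ((norm_sum_le _ _).trans
      (Finset.sum_le_sum fun m hm ↦ ?_)) ?_)
    · have hm' := Finset.mem_range.1 hm
      have hm'' : m + 1 ≤ q + 1 := by omega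
      rw [star_pow_mul_neg_mul_star_pow _ _ _ hm'', entryCLM_apply, Matrix.neg_apply, norm_neg,
        mul_single_mul_apply, norm_mul, star_pow_apply (U : Matrix (Fin N) (Fin N) ℂ) (q + 1 - (m + 1)), RCLike.norm_conj,
        Nat.add_sub_add_right]
      refine mul_le_of_le_one_left (norm_nonneg _) ?_
      rcases le_total (m + 1) (p + 1) with h | h
      · rw [star_pow_mul_pow _ h]
        exact norm_pow_apply_le_one _ _ _ _
      · rw [star_pow_mul_pow' _ h, star_pow_apply, RCLike.norm_conj]
        exact norm_pow_apply_le_one _ _ _ _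
    · rw [star_pow_mul_neg_mul_star_pow _ _ _ q.lt_succ_self, entryCLM_apply, Matrix.neg_apply,
        mul_single_mul_apply, Nat.sub_self, pow_zero, Matrix.one_apply]
      by_cases hk : i = k
      · subst hk
        simp only [if_true, mul_one, true_and]
        rw [neg_add_eq_sub, norm_sub_rev]
      · simp [hk, Ne.symm hk]
  refine (integral_mono_of_nonneg (Eventually.of_forall fun U ↦ norm_nonneg _)
    ((integrable_finsetSum _ fun m _ ↦ hint (q - m)).add hint₀) (Eventually.of_forall hpt)).trans ?_
  simp only [Pi.add_apply]
  rw [integral_add (integrable_finsetSum _ fun m _ ↦ hint (q - m)) hint₀,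
    integral_finsetSum _ fun m _ ↦ hint _, add_div, Finset.sum_div]
  refine add_le_add (Finset.sum_le_sum fun m hm ↦ ?_) (hC₀ N μ hN j l)
  have := hC (q - (m + 1)) N μ hN k i
  rwa [show q - (m + 1) + 1 = q - m by have := Finset.mem_range.1 hm; omega] at this

end Stein

/-! ### The Stein identity and the characteristic function of linear statistics. -/

section LinearStatistic

variable {N : ℕ} {ι : Type*} [Fintype ι]

/-- The real linear statistic `∑ s, Re (conj (c s) * √N * (U ^ (q s + 1)) (k s) (l s))`,
as a complex number. -/
noncomputable def linStat (q : ι → ℕ) (c : ι → ℂ) (k l : ι → Fin N)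
    (U : Matrix.unitaryGroup (Fin N) ℂ) : ℂ :=
  ∑ s, ((((√N : ℝ) : ℂ) / 2 * conj (c s)) * ((U : Matrix (Fin N) (Fin N) ℂ) ^ (q s + 1)) (k s) (l s)
    + (((√N : ℝ) : ℂ) / 2 * c s) * (star (U : Matrix (Fin N) (Fin N) ℂ) ^ (q s + 1)) (l s) (k s))

/-- The definition is polynomial in `U` and `U*`, which suits differentiation; realness makes `exp
(i t ℓ)` unimodular and matches the real inner product in `charFun`. -/
lemma linStat_eq_ofReal (q : ι → ℕ) (c : ι → ℂ) (k l : ι → Fin N)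
    (U : Matrix.unitaryGroup (Fin N) ℂ) :
    linStat q c k l U = ((∑ s, (conj (c s) * (((√N : ℝ) : ℂ) *
      ((U : Matrix (Fin N) (Fin N) ℂ) ^ (q s + 1)) (k s) (l s))).re : ℝ) : ℂ) := by
  rw [Complex.ofReal_sum, linStat]
  refine Finset.sum_congr rfl fun s _ ↦ ?_
  rw [Complex.re_eq_add_conj, star_pow_apply]
  simp only [map_mul, Complex.conj_conj, Complex.conj_ofReal]
  ring

lemma norm_exp_I_mul_linStat (q : ι → ℕ) (c : ι → ℂ) (k l : ι → Fin N) (t : ℝ)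
    (U : Matrix.unitaryGroup (Fin N) ℂ) : ‖Complex.exp (Complex.I * t * linStat q c k l U)‖ = 1 := by
  rw [linStat_eq_ofReal, mul_assoc, ← Complex.ofReal_mul, mul_comm, Complex.norm_exp_ofReal_mul_I]

lemma conj_exp_I_mul_linStat (q : ι → ℕ) (c : ι → ℂ) (k l : ι → Fin N) (t : ℝ)
    (U : Matrix.unitaryGroup (Fin N) ℂ) :
    conj (Complex.exp (Complex.I * t * linStat q c k l U)) =
      Complex.exp (Complex.I * (-t : ℝ) * linStat q c k l U) := by
  obtain ⟨x, hx⟩ : ∃ x : ℝ, linStat q c k l U = x := ⟨_, linStat_eq_ofReal q c k l U⟩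
  rw [hx, ← Complex.exp_conj]
  simp only [map_mul, Complex.conj_ofReal, Complex.conj_I, Complex.ofReal_neg]
  ring_nf

lemma hasLeftDeriv_linStat (q : ι → ℕ) (c : ι → ℂ) (k l : ι → Fin N) :
    HasLeftDeriv (linStat q c k l) (fun U X ↦ ∑ s,
      ((((√N : ℝ) : ℂ) / 2 * conj (c s)) * entryCLM (k s) (l s)
        (∑ m ∈ Finset.range (q s + 1), (U : Matrix (Fin N) (Fin N) ℂ) ^ m *
          (X * U) * (U : Matrix (Fin N) (Fin N) ℂ) ^ (q s + 1 - 1 - m)) +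
      (((√N : ℝ) : ℂ) / 2 * c s) * entryCLM (l s) (k s)
        (∑ m ∈ Finset.range (q s + 1), star (U : Matrix (Fin N) (Fin N) ℂ) ^ m *
          -(star (U : Matrix (Fin N) (Fin N) ℂ) * X) *
          star (U : Matrix (Fin N) (Fin N) ℂ) ^ (q s + 1 - 1 - m)))) :=
  HasLeftDeriv.sum _ fun s _ ↦
    ((hasLeftDeriv_coe.pow (q s + 1)).clm_comp
      ((((√N : ℝ) : ℂ) / 2 * conj (c s)) • entryCLM (k s) (l s))).add
    ((hasLeftDeriv_star.pow (q s + 1)).clm_comp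
      ((((√N : ℝ) : ℂ) / 2 * c s) • entryCLM (l s) (k s)))

lemma norm_integral_mul_le {μ : Measure (Matrix.unitaryGroup (Fin N) ℂ)} [IsFiniteMeasure μ]
    {f g : Matrix.unitaryGroup (Fin N) ℂ → ℂ} (hf : Continuous f) (hg : ∀ U, ‖g U‖ ≤ 1) {C : ℝ}
    (h : ∫ U, ‖f U‖ ∂μ ≤ C) : ‖∫ U, f U * g U ∂μ‖ ≤ C :=
  (norm_integral_le_of_norm_le (integrable_of_continuous_unitaryGroup hf.norm)
    (Eventually.of_forall fun U ↦ by
      rw [norm_mul]; exact mul_le_of_le_one_right (norm_nonneg _) (hg U))).trans h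

/-- Approximate Stein identity for the scaled entries of the powers of a Haar unitary matrix. -/
lemma exists_norm_integral_pow_mul_exp_sub_le (q : ι → ℕ) (c : ι → ℂ) (s₀ : ι) : ∃ C : ℝ,
    ∀ (N : ℕ) (μ : Measure (Matrix.unitaryGroup (Fin N) ℂ)) [IsProbabilityMeasure μ]
      [μ.IsMulLeftInvariant], 1 ≤ N → ∀ k l : ι → Fin N,
      (Function.Injective fun s ↦ (q s, k s, l s)) → ∀ t : ℝ, |t| ≤ 1 →
      ‖((√N : ℝ) : ℂ) * ∫ U : Matrix.unitaryGroup (Fin N) ℂ,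
          ((U : Matrix (Fin N) (Fin N) ℂ) ^ (q s₀ + 1)) (k s₀) (l s₀) *
            Complex.exp (Complex.I * t * linStat q c k l U) ∂μ -
        Complex.I * t / 2 * c s₀ * ∫ U, Complex.exp (Complex.I * t * linStat q c k l U) ∂μ‖
      ≤ C / √N := by
  obtain ⟨C₀, hC₀⟩ := exists_norm_integral_trace_mul_pow_le (q s₀)
  choose A hA using exists_integral_norm_deriv_pow_le (q s₀)
  choose B hB using exists_integral_norm_deriv_star_pow_le (q s₀)
  -- `C₀` bounds the trace terms, `A` and `B` the derivatives of the entries of `U` and `U*`; `1 /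
  -- 2` bounds `|i t / 2|`. None depends on `N`, `k` or `l`.
  refine ⟨C₀ + 1 / 2 * ∑ s, ‖c s‖ * (A (q s) + B (q s)), fun N μ _ _ hN k l hinj t ht ↦ ?_⟩
  have hN0 : (0 : ℝ) < √N := Real.sqrt_pos.2 (by exact_mod_cast hN)
  have hNN : ((√N : ℝ) : ℂ) * ((√N : ℝ) : ℂ) = N := by
    rw [← Complex.ofReal_mul, Real.mul_self_sqrt (by positivity)]
    simp
  have hNC : ((√N : ℝ) : ℂ) ≠ 0 := Complex.ofReal_ne_zero.2 hN0.ne'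
  have hℓ := hasLeftDeriv_linStat q c k l
  have hg := (hℓ.clm_comp ((Complex.I * t) • ContinuousLinearMap.id ℂ ℂ)).cexp
  simp only [smul_apply, ContinuousLinearMap.id_apply, smul_eq_mul] at hg
  set g : Matrix.unitaryGroup (Fin N) ℂ → ℂ := fun U ↦
    Complex.exp (Complex.I * t * linStat q c k l U) with hgdef
  have hg1 : ∀ U, ‖g U‖ ≤ 1 := fun U ↦ (norm_exp_I_mul_linStat q c k l t U).le
  have hgc : Continuous g := hg.continuous
  have hsd := schwingerDyson_succ (μ := μ) hg (q s₀) (k s₀) (l s₀)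
  set Φ := ∫ U, g U ∂μ with hΦ
  set S := ∫ U : Matrix.unitaryGroup (Fin N) ℂ,
        (∑ m ∈ Finset.range (q s₀), ((U : Matrix (Fin N) (Fin N) ℂ) ^ (m + 1)).trace *
          ((U : Matrix (Fin N) (Fin N) ℂ) ^ (q s₀ - m)) (k s₀) (l s₀)) * g U ∂μ with hS
  have hS_le : ‖S‖ ≤ C₀ := hC₀ N μ hN _ _ g hgc hg1
  set a : ι → Matrix.unitaryGroup (Fin N) ℂ → ℂ := fun s U ↦ entryCLM (k s) (l s)
    (∑ m ∈ Finset.range (q s + 1), (U : Matrix (Fin N) (Fin N) ℂ) ^ m *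
      ((U : Matrix (Fin N) (Fin N) ℂ) ^ (q s₀ + 1) * Matrix.single (l s₀) (k s₀) (1 : ℂ) * U) *
      (U : Matrix (Fin N) (Fin N) ℂ) ^ (q s + 1 - 1 - m)) with ha
  set b : ι → Matrix.unitaryGroup (Fin N) ℂ → ℂ := fun s U ↦ entryCLM (l s) (k s)
    (∑ m ∈ Finset.range (q s + 1), star (U : Matrix (Fin N) (Fin N) ℂ) ^ m *
      -(star (U : Matrix (Fin N) (Fin N) ℂ) * ((U : Matrix (Fin N) (Fin N) ℂ) ^ (q s₀ + 1) *
        Matrix.single (l s₀) (k s₀) (1 : ℂ))) *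
      star (U : Matrix (Fin N) (Fin N) ℂ) ^ (q s + 1 - 1 - m)) with hb
  set δ : ι → ℂ := fun s ↦ if q s = q s₀ ∧ k s = k s₀ ∧ l s = l s₀ then 1 else 0 with hδ
  have hac : ∀ s, Continuous (a s) := fun s ↦
    ((hasLeftDeriv_coe.pow (q s + 1)).clm_comp
      (entryCLM (k s) (l s))).continuous_deriv_pow_mul_single _ _ _
  have hbc : ∀ s, Continuous (b s) := fun s ↦
    ((hasLeftDeriv_star.pow (q s + 1)).clm_comp
      (entryCLM (l s) (k s))).continuous_deriv_pow_mul_single _ _ _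
  have ha_le : ∀ s, ‖∫ U, a s U * g U ∂μ‖ ≤ A (q s) / √N := fun s ↦
    norm_integral_mul_le (hac s) hg1 (hA (q s) N μ hN _ _ _ _)
  have hb_le : ∀ s, ‖∫ U, (b s U + δ s) * g U ∂μ‖ ≤ B (q s) / √N := fun s ↦
    norm_integral_mul_le ((hbc s).add continuous_const) hg1 (hB (q s) N μ hN _ _ _ _)
  -- Distinct indices give distinct triples (power, row, column), so the covariance is diagonal.
  have hδ_sum : ∑ s, c s * δ s = c s₀ := by
    rw [Finset.sum_eq_single s₀]
    · simp [hδ]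
    · intro s _ hs
      have : ¬(q s = q s₀ ∧ k s = k s₀ ∧ l s = l s₀) := fun h ↦
        hs (hinj (by simp only [h.1, h.2.1, h.2.2]))
      simp [hδ, this]
    · simp
  set M : ℂ := ∑ s, (conj (c s) * ∫ U, a s U * g U ∂μ + c s * ∫ U, (b s U + δ s) * g U ∂μ) with hM
  have hM_le : ‖M‖ ≤ (∑ s, ‖c s‖ * (A (q s) + B (q s))) / √N := by
    rw [Finset.sum_div]
    refine (norm_sum_le _ _).trans (Finset.sum_le_sum fun s _ ↦ (norm_add_le _ _).trans ?_)
    rw [norm_mul, norm_mul, RCLike.norm_conj, ← mul_add, mul_div_assoc, add_div]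
    exact mul_le_mul_of_nonneg_left (add_le_add (ha_le s) (hb_le s)) (norm_nonneg _)
  have hder : ∫ U, g U * (Complex.I * t * ∑ s, (((√N : ℝ) : ℂ) / 2 * conj (c s) * a s U +
      ((√N : ℝ) : ℂ) / 2 * c s * b s U)) ∂μ =
      Complex.I * t * (((√N : ℝ) : ℂ) / 2) * (M - c s₀ * Φ) := by
    have hintM : ∀ s, Integrable (fun U ↦ conj (c s) * (a s U * g U) +
        c s * ((b s U + δ s) * g U)) μ := fun s ↦ integrable_of_continuous_unitaryGroup
      ((continuous_const.mul ((hac s).mul hgc)).add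
        (continuous_const.mul (((hbc s).add continuous_const).mul hgc)))
    have hMeq : M = ∫ U, ∑ s, (conj (c s) * (a s U * g U) + c s * ((b s U + δ s) * g U)) ∂μ := by
      rw [integral_finsetSum _ fun s _ ↦ hintM s]
      refine Finset.sum_congr rfl fun s _ ↦ ?_
      rw [integral_add, integral_const_mul, integral_const_mul]
      · exact integrable_of_continuous_unitaryGroup (continuous_const.mul ((hac s).mul hgc))
      · exact integrable_of_continuous_unitaryGroup
          (continuous_const.mul (((hbc s).add continuous_const).mul hgc))
    rw [hMeq, hΦ, ← integral_const_mul, ← integral_sub, ← integral_const_mul]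
    · refine integral_congr_ae (Eventually.of_forall fun U ↦ ?_)
      simp only
      rw [← hδ_sum, Finset.sum_mul, ← Finset.sum_sub_distrib, Finset.mul_sum, Finset.mul_sum,
        Finset.mul_sum]
      refine Finset.sum_congr rfl fun s _ ↦ ?_
      ring
    · exact integrable_finsetSum _ fun s _ ↦ hintM s
    · exact (integrable_of_continuous_unitaryGroup hgc).const_mul _
  have hsd' : (N : ℂ) * ∫ U : Matrix.unitaryGroup (Fin N) ℂ,
      ((U : Matrix (Fin N) (Fin N) ℂ) ^ (q s₀ + 1)) (k s₀) (l s₀) * g U ∂μ + S +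
      Complex.I * t * (((√N : ℝ) : ℂ) / 2) * (M - c s₀ * Φ) = 0 := by
    rw [← hder]
    exact hsd
  -- Splitting `N` as `√N * √N` and dividing by one factor leaves the errors `S / √N` and `M`, both
  -- of order `N ^ (-1/2)`.
  rw [← hNN] at hsd'
  have hfin : ((√N : ℝ) : ℂ) * ∫ U : Matrix.unitaryGroup (Fin N) ℂ,
      ((U : Matrix (Fin N) (Fin N) ℂ) ^ (q s₀ + 1)) (k s₀) (l s₀) * g U ∂μ -
        Complex.I * t / 2 * c s₀ * Φ = -(S / ((√N : ℝ) : ℂ)) - Complex.I * t / 2 * M := by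
    apply mul_left_cancel₀ hNC
    rw [mul_sub, mul_sub, mul_neg, mul_div_cancel₀ _ hNC]
    linear_combination hsd'
  rw [hfin, add_div]
  refine (norm_sub_le _ _).trans (add_le_add ?_ ?_)
  · rw [norm_neg, norm_div, Complex.norm_real, Real.norm_of_nonneg hN0.le]
    gcongr
  · have hI : ‖Complex.I * t / 2‖ ≤ 1 / 2 := by
      rw [norm_div, norm_mul, Complex.norm_I, Complex.norm_real, Real.norm_eq_abs, one_mul,
        Complex.norm_ofNat]
      linarith
    rw [norm_mul, mul_div_assoc (1 / 2 : ℝ)]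
    exact mul_le_mul hI hM_le (norm_nonneg _) (by norm_num)

/-- The characteristic function of the scaled entries of the powers of a Haar unitary matrix. -/
lemma exists_norm_integral_exp_linStat_sub_le (q : ι → ℕ) (c : ι → ℂ) : ∃ C : ℝ,
    ∀ (N : ℕ) (μ : Measure (Matrix.unitaryGroup (Fin N) ℂ)) [IsProbabilityMeasure μ]
      [μ.IsMulLeftInvariant], 1 ≤ N → ∀ k l : ι → Fin N,
      (Function.Injective fun s ↦ (q s, k s, l s)) →
      ‖∫ U, Complex.exp (Complex.I * linStat q c k l U) ∂μ -
        (Real.exp (-(∑ s, ‖c s‖ ^ 2) / 4) : ℝ)‖ ≤ C / √N := by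
  choose C hC using exists_norm_integral_pow_mul_exp_sub_le q c
  refine ⟨∑ s, ‖c s‖ * C s, fun N μ _ _ hN k l hinj ↦ ?_⟩
  set ℓ := linStat q c k l with hℓ
  have hℓc : Continuous ℓ := (hasLeftDeriv_linStat q c k l).continuous
  set φ : ℝ → ℂ := fun t ↦ ∫ U, Complex.exp (Complex.I * t * ℓ U) ∂μ with hφ
  have hec : ∀ t : ℝ, Continuous fun U ↦ Complex.exp (Complex.I * t * ℓ U) := fun t ↦
    Complex.continuous_exp.comp (continuous_const.mul hℓc)
  have hd : ∀ t : ℝ, HasDerivAt φ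
      (∫ U, Complex.I * ℓ U * Complex.exp (Complex.I * t * ℓ U) ∂μ) t := by
    intro t
    refine (hasDerivAt_integral_of_dominated_loc_of_deriv_le (μ := μ) (x₀ := t)
      (s := Set.univ) (F := fun (t : ℝ) U ↦ Complex.exp (Complex.I * t * ℓ U))
      (F' := fun (t : ℝ) U ↦ Complex.I * ℓ U * Complex.exp (Complex.I * t * ℓ U))
      (bound := fun U ↦ ‖ℓ U‖) univ_mem
      (Eventually.of_forall fun t ↦
        (integrable_of_continuous_unitaryGroup (hec t)).aestronglyMeasurable)
      (integrable_of_continuous_unitaryGroup (hec t))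
      (integrable_of_continuous_unitaryGroup
        ((continuous_const.mul hℓc).mul (hec t))).aestronglyMeasurable
      (Eventually.of_forall fun U t _ ↦ ?_)
      (integrable_of_continuous_unitaryGroup hℓc.norm)
      (Eventually.of_forall fun U t _ ↦ ?_)).2
    · rw [norm_mul, norm_exp_I_mul_linStat, norm_mul, Complex.norm_I, one_mul, mul_one]
    · have h1 : HasDerivAt (fun t : ℝ ↦ Complex.I * t * ℓ U) (Complex.I * ℓ U) t := by
        simpa using ((hasDerivAt_id t).ofReal_comp.const_mul Complex.I).mul_const (ℓ U)
      simpa [mul_comm] using h1.cexp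
  set E : ι → ℝ → ℂ := fun s t ↦ ((√N : ℝ) : ℂ) * ∫ U : Matrix.unitaryGroup (Fin N) ℂ,
      ((U : Matrix (Fin N) (Fin N) ℂ) ^ (q s + 1)) (k s) (l s) *
        Complex.exp (Complex.I * t * ℓ U) ∂μ with hE
  have hE_le : ∀ s (t : ℝ), |t| ≤ 1 → ‖E s t - Complex.I * t / 2 * c s * φ t‖ ≤ C s / √N :=
    fun s t ht ↦ hC s N μ hN k l hinj t ht
  -- Conjugation with `t ↦ -t` carries the Stein identity for entries of `U` over to entries of
  -- `U*`.
  have hφ_conj : ∀ t : ℝ, conj (φ (-t)) = φ t := by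
    intro t
    simp only [hφ]
    rw [← integral_conj]
    refine integral_congr_ae (Eventually.of_forall fun U ↦ ?_)
    simp only
    rw [conj_exp_I_mul_linStat, neg_neg]
  have hE_conj : ∀ s (t : ℝ), conj (E s (-t)) = ((√N : ℝ) : ℂ) *
      ∫ U : Matrix.unitaryGroup (Fin N) ℂ,
        (star (U : Matrix (Fin N) (Fin N) ℂ) ^ (q s + 1)) (l s) (k s) *
        Complex.exp (Complex.I * t * ℓ U) ∂μ := by
    intro s t
    simp only [hE]
    rw [map_mul, Complex.conj_ofReal, ← integral_conj]
    congr 1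
    refine integral_congr_ae (Eventually.of_forall fun U ↦ ?_)
    simp only
    rw [map_mul, conj_exp_I_mul_linStat, neg_neg, star_pow_apply]
  have hderiv : ∀ t : ℝ, ∫ U, Complex.I * ℓ U * Complex.exp (Complex.I * t * ℓ U) ∂μ =
      Complex.I * ∑ s, (conj (c s) / 2 * E s t + c s / 2 * conj (E s (-t))) := by
    intro t
    have hi1 : ∀ s, Integrable (fun U : Matrix.unitaryGroup (Fin N) ℂ ↦
        ((U : Matrix (Fin N) (Fin N) ℂ) ^ (q s + 1)) (k s) (l s) *
          Complex.exp (Complex.I * t * ℓ U)) μ := fun s ↦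
      integrable_of_continuous_unitaryGroup ((continuous_pow_apply _ _ _).mul (hec t))
    have hi2 : ∀ s, Integrable (fun U : Matrix.unitaryGroup (Fin N) ℂ ↦
        (star (U : Matrix (Fin N) (Fin N) ℂ) ^ (q s + 1)) (l s) (k s) *
          Complex.exp (Complex.I * t * ℓ U)) μ := fun s ↦
      integrable_of_continuous_unitaryGroup (((hasLeftDeriv_star.pow (q s + 1)).clm_comp
        (entryCLM (l s) (k s))).continuous.mul (hec t))
    have hpt : ∀ U, Complex.I * ℓ U * Complex.exp (Complex.I * t * ℓ U) = Complex.I *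
        ∑ s, ((((√N : ℝ) : ℂ) / 2 * conj (c s)) *
            (((U : Matrix (Fin N) (Fin N) ℂ) ^ (q s + 1)) (k s) (l s) *
              Complex.exp (Complex.I * t * ℓ U)) +
          (((√N : ℝ) : ℂ) / 2 * c s) *
            ((star (U : Matrix (Fin N) (Fin N) ℂ) ^ (q s + 1)) (l s) (k s) *
              Complex.exp (Complex.I * t * ℓ U))) := by
      intro U
      rw [mul_assoc]
      congr 1
      simp only [hℓ]
      nth_rw 1 [linStat]
      rw [Finset.sum_mul]
      refine Finset.sum_congr rfl fun s _ ↦ ?_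
      ring
    simp_rw [hpt]
    rw [integral_const_mul, integral_finsetSum]
    swap
    · exact fun s _ ↦ ((hi1 s).const_mul _).add ((hi2 s).const_mul _)
    congr 1
    refine Finset.sum_congr rfl fun s _ ↦ ?_
    rw [integral_add ((hi1 s).const_mul _) ((hi2 s).const_mul _), integral_const_mul,
      integral_const_mul, hE_conj]
    simp only [hE]
    ring
  have key := norm_sub_exp_le_of_norm_deriv_add_le (σ := ∑ s, ‖c s‖ ^ 2)
    (ε := (∑ s, ‖c s‖ * C s) / √N) (Finset.sum_nonneg fun s _ ↦ by positivity) hd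
    (by simp [hφ]) ?_
  · simpa [hφ] using key
  intro t ht
  have ht1 : |t| ≤ 1 := by rw [abs_le]; constructor <;> linarith [ht.1, ht.2]
  -- The main terms of the identities at `t` and `-t` each contribute `-(t/4) ‖c s‖ ^ 2 φ t` to the
  -- derivative, exactly cancelling the added drift; only Stein errors remain.
  have hsplit : (∫ U, Complex.I * ℓ U * Complex.exp (Complex.I * t * ℓ U) ∂μ) +
      (t / 2 * ∑ s, ‖c s‖ ^ 2 : ℝ) * φ t =
      Complex.I * ∑ s, (conj (c s) / 2 * (E s t - Complex.I * t / 2 * c s * φ t) +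
        c s / 2 * conj (E s (-t) - Complex.I * (-t : ℝ) / 2 * c s * φ (-t))) := by
    rw [hderiv]
    push_cast
    rw [Finset.mul_sum, Finset.mul_sum, Finset.mul_sum, Finset.sum_mul, ← Finset.sum_add_distrib]
    refine Finset.sum_congr rfl fun s _ ↦ ?_
    have hn : ((‖c s‖ : ℂ)) ^ 2 = conj (c s) * c s := by
      rw [← Complex.normSq_eq_conj_mul_self, Complex.normSq_eq_norm_sq]
      push_cast
      rfl
    rw [hn]
    simp only [map_sub, map_mul, map_div₀, map_neg, Complex.conj_I, Complex.conj_ofReal, hφ_conj,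
      Complex.conj_ofNat]
    linear_combination ((t : ℂ) / 2 * conj (c s) * c s * φ t) * Complex.I_sq
  rw [hsplit, norm_mul, Complex.norm_I, one_mul, Finset.sum_div]
  refine (norm_sum_le _ _).trans (Finset.sum_le_sum fun s _ ↦ (norm_add_le _ _).trans ?_)
  rw [norm_mul, norm_mul, RCLike.norm_conj, norm_div, norm_div, RCLike.norm_conj,
    Complex.norm_ofNat]
  have h1 := mul_le_mul_of_nonneg_left (hE_le s t ht1) (norm_nonneg (c s))
  have h2 := mul_le_mul_of_nonneg_left (hE_le s (-t) (by rwa [abs_neg])) (norm_nonneg (c s))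
  rw [mul_div_assoc ‖c s‖]
  linarith

end LinearStatistic

/-! ### From finite marginals to a countable product. -/

section ProductConvergence

/-- An open set in a product space is the union of a family of open cylinders over the finite
coordinate sets, which is directed upwards. -/
lemma exists_directed_open_cylinders {ι E : Type*} [TopologicalSpace E] {G : Set (ι → E)}
    (hG : IsOpen G) : ∃ O : (s : Finset ι) → Set (s → E), (∀ s, IsOpen (O s)) ∧
      Directed (· ⊆ ·) (fun s ↦ {x : ι → E | (fun i : s ↦ x i) ∈ O s}) ∧
      ⋃ s, {x : ι → E | (fun i : s ↦ x i) ∈ O s} = G := by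
  classical
  -- The largest open set whose cylinder lies in `G`; maximality makes the family directed.
  let O : (s : Finset ι) → Set (s → E) := fun s ↦
    ⋃₀ {V | IsOpen V ∧ ∀ x : ι → E, (fun i : s ↦ x i) ∈ V → x ∈ G}
  refine ⟨O, fun s ↦ isOpen_sUnion fun V hV ↦ hV.1, ?_, ?_⟩
  · refine directed_of_isDirected_le fun s t hst x hx ↦ ?_
    obtain ⟨V, ⟨hV, hVG⟩, hxV⟩ := hx
    refine ⟨{f | (fun i : s ↦ f ⟨i, hst i.2⟩) ∈ V}, ⟨hV.preimage (by fun_prop), fun y hy ↦ ?_⟩, hxV⟩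
    exact hVG y hy
  · ext x
    rw [Set.mem_iUnion]
    constructor
    · rintro ⟨s, V, ⟨-, hVG⟩, hxV⟩
      exact hVG x hxV
    · intro hx
      obtain ⟨s, u, hu, hsub⟩ := isOpen_pi_iff.1 hG x hx
      refine ⟨s, Set.univ.pi fun i : s ↦ u i,
        ⟨isOpen_set_pi Set.finite_univ fun i _ ↦ (hu i i.2).1, fun y hy ↦ hsub fun i hi ↦ ?_⟩,
        fun i _ ↦ (hu i i.2).2⟩
      exact hy ⟨i, hi⟩ trivial

/-- Convergence in distribution in a countable product follows from the convergence of the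
finite-dimensional marginals. -/
lemma tendstoInDistribution_of_forall_finset {ι E : Type*} [Countable ι] [TopologicalSpace E]
    [MeasurableSpace E] [BorelSpace E] [SecondCountableTopology E]
    [∀ s : Finset ι, HasOuterApproxClosed (s → E)]
    {Ω : ℕ → Type*} [∀ N, MeasurableSpace (Ω N)] {P : ∀ N, Measure (Ω N)}
    [∀ N, IsProbabilityMeasure (P N)] {Ω' : Type*} [MeasurableSpace Ω'] {P' : Measure Ω'}
    [IsProbabilityMeasure P'] {X : ∀ N, Ω N → ι → E} {Z : Ω' → ι → E}
    (h : ∀ s : Finset ι, TendstoInDistribution (fun N ω (i : s) ↦ X N ω i) atTop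
      (fun ω (i : s) ↦ Z ω i) P P') :
    TendstoInDistribution X atTop Z P P' := by
  have hX : ∀ N, AEMeasurable (X N) (P N) := fun N ↦ aemeasurable_pi_iff.2 fun i ↦
    aemeasurable_pi_iff.1 ((h {i}).forall_aemeasurable N) ⟨i, Finset.mem_singleton_self i⟩
  have hZ : AEMeasurable Z P' := aemeasurable_pi_iff.2 fun i ↦
    aemeasurable_pi_iff.1 (h {i}).aemeasurable_limit ⟨i, Finset.mem_singleton_self i⟩
  -- Portmanteau: the `liminf` inequality for open sets passes from cylinders to their directed
  -- union by continuity from below, as there are countably many finite coordinate sets.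
  refine ⟨hX, hZ, tendsto_of_forall_isOpen_le_liminf' fun G hG ↦ ?_⟩
  obtain ⟨O, hO, hdir, hU⟩ := exists_directed_open_cylinders hG
  simp only [ProbabilityMeasure.coe_mk]
  conv_lhs => rw [← hU]
  rw [hdir.measure_iUnion]
  refine iSup_le fun s ↦ ?_
  have hs := ProbabilityMeasure.le_liminf_measure_open_of_tendsto (h s).tendsto (hO s)
  simp only [ProbabilityMeasure.coe_mk] at hs
  have hr : Measurable (fun (x : ι → E) (i : s) ↦ x i) :=
    measurable_pi_lambda _ fun i ↦ measurable_pi_apply _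
  refine (Measure.map_apply_of_aemeasurable hZ (hr (hO s).measurableSet)).trans_le ?_
  rw [Measure.map_apply_of_aemeasurable (h s).aemeasurable_limit (hO s).measurableSet] at hs
  refine hs.trans (liminf_le_liminf (Eventually.of_forall fun N ↦ ?_))
  rw [Measure.map_apply_of_aemeasurable ((h s).forall_aemeasurable N) (hO s).measurableSet,
    Measure.map_apply_of_aemeasurable (hX N) hG.measurableSet]
  refine measure_mono fun ω hω ↦ ?_
  have : X N ω ∈ ⋃ s : Finset ι, {x : ι → E | (fun i : s ↦ x i) ∈ O s} :=
    Set.mem_iUnion.2 ⟨s, hω⟩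
  rwa [hU] at this

end ProductConvergence

/-! ### The characteristic function of the complex Gaussian. -/

section Gaussian

lemma charFun_stdComplexGaussian (w : ℂ) :
    charFun stdComplexGaussian w = (Real.exp (-‖w‖ ^ 2 / 4) : ℝ) := by
  rw [charFun_apply, stdComplexGaussian, integral_withDensity_eq_integral_toReal_smul
    (by fun_prop) (Eventually.of_forall fun _ ↦ ENNReal.ofReal_lt_top)]
  have h := GaussianFourier.integral_cexp_neg_mul_sq_norm_add (V := ℂ) (b := 1) (by simp)
    Complex.I w
  have hpi : (Real.pi : ℂ) ≠ 0 := Complex.ofReal_ne_zero.2 Real.pi_ne_zero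
  have h2 : ∀ z : ℂ, (ENNReal.ofReal (Real.pi⁻¹ * Real.exp (-‖z‖ ^ 2))).toReal •
      Complex.exp (inner ℝ z w * Complex.I) =
      (Real.pi : ℂ)⁻¹ * Complex.exp (-1 * ‖z‖ ^ 2 + Complex.I * inner ℝ w z) := by
    intro z
    rw [ENNReal.toReal_ofReal (by positivity), Complex.real_smul, Complex.exp_add,
      real_inner_comm]
    push_cast
    rw [mul_assoc, neg_one_mul, mul_comm Complex.I]
  simp_rw [h2]
  rw [integral_const_mul, h, Complex.finrank_real_complex]
  simp only [div_one, Nat.cast_ofNat, Complex.I_sq]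
  rw [div_self (by norm_num), Complex.cpow_one, ← mul_assoc, inv_mul_cancel₀ hpi, one_mul]
  push_cast
  ring_nf

end Gaussian

/-! ### Lévy continuity and the conclusion. -/

section Assembly

lemma IsHaarDistributed.isMulLeftInvariant {Ω : Type*} [MeasurableSpace Ω] {N : ℕ}
    {U : Ω → Matrix.unitaryGroup (Fin N) ℂ} {P : Measure Ω} (h : IsHaarDistributed U P) :
    (P.map U).IsMulLeftInvariant := h.isHaarMeasure.toIsMulLeftInvariant

lemma continuous_scaledPowerEntry (n : ℕ) {N : ℕ} (p : ℕ+) (i j : Fin n) :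
    Continuous fun U : Matrix.unitaryGroup (Fin N) ℂ ↦ scaledPowerEntry n U p i j := by
  unfold scaledPowerEntry topLeftBlock
  split_ifs with h
  · exact continuous_const.mul (continuous_pow_apply _ _ _)
  · exact continuous_const

lemma tendsto_charFun_scaledPowerEntry (n : ℕ)
    {Ω : ℕ → Type*} [∀ N, MeasurableSpace (Ω N)]
    (P : ∀ N, Measure (Ω N)) [∀ N, IsProbabilityMeasure (P N)]
    (U : ∀ N, Ω N → Matrix.unitaryGroup (Fin N) ℂ)
    (hU : ∀ N, IsHaarDistributed (U N) (P N)) (s : Finset (ℕ+ × Fin n × Fin n))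
    (c : PiLp 2 fun _ : s ↦ ℂ) :
    Tendsto (fun N ↦ charFun ((P N).map fun ω ↦ WithLp.toLp 2 fun x : s ↦
        scaledPowerEntry n (U N ω) x.1.1 x.1.2.1 x.1.2.2) c)
      atTop (𝓝 (Real.exp (-(∑ x, ‖c x‖ ^ 2) / 4) : ℝ)) := by
  -- `linStat` uses the exponent `q + 1`, so `q` is the power minus one; positivity of the power
  -- keeps this injective.
  obtain ⟨C, hC⟩ := exists_norm_integral_exp_linStat_sub_le
    (fun x : s ↦ (x.1.1 : ℕ) - 1) (fun x ↦ c x)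
  have hlim : Tendsto (fun N : ℕ ↦ C / √(N : ℝ)) atTop (𝓝 0) :=
    (Real.tendsto_sqrt_atTop.comp tendsto_natCast_atTop_atTop).const_div_atTop C
  rw [tendsto_iff_norm_sub_tendsto_zero]
  refine squeeze_zero' (Eventually.of_forall fun N ↦ norm_nonneg _) ?_ hlim
  filter_upwards [eventually_ge_atTop n, eventually_ge_atTop 1] with N hnN hN
  have : IsProbabilityMeasure ((P N).map (U N)) :=
    Measure.isProbabilityMeasure_map (hU N).aemeasurable
  have := (hU N).isMulLeftInvariant
  have key := hC N ((P N).map (U N)) hN (fun x ↦ Fin.castLE hnN x.1.2.1)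
    (fun x ↦ Fin.castLE hnN x.1.2.2) (by
      rintro ⟨⟨p, i, j⟩, hx⟩ ⟨⟨p', i', j'⟩, hy⟩ hxy
      simp only [Prod.mk.injEq, Fin.castLE_inj] at hxy
      obtain ⟨h1, rfl, rfl⟩ := hxy
      have hp : p = p' := PNat.eq (by have := p.pos; have := p'.pos; omega)
      subst hp
      rfl)
  have hmeas : AEMeasurable (fun ω ↦ WithLp.toLp 2 fun x : s ↦
      scaledPowerEntry n (U N ω) x.1.1 x.1.2.1 x.1.2.2) (P N) :=
    (PiLp.continuous_toLp 2 _).measurable.comp_aemeasurable (aemeasurable_pi_iff.2 fun x ↦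
      (continuous_scaledPowerEntry n _ _ _).measurable.comp_aemeasurable (hU N).aemeasurable)
  refine le_of_eq_of_le ?_ key
  congr 2
  rw [charFun_apply, integral_map hmeas, integral_map (hU N).aemeasurable]
  · refine integral_congr_ae (Eventually.of_forall fun ω ↦ ?_)
    simp only
    rw [mul_comm Complex.I, linStat_eq_ofReal, PiLp.inner_apply]
    congr 3
    refine Finset.sum_congr rfl fun x _ ↦ ?_
    simp only [scaledPowerEntry, topLeftBlock, dif_pos hnN, Nat.sub_add_cancel x.1.1.pos]
    rw [real_inner_comm, Complex.inner, mul_comm]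
  · exact (Complex.continuous_exp.comp (continuous_const.mul
      (hasLeftDeriv_linStat _ _ _ _).continuous)).aestronglyMeasurable
  · exact (by fun_prop : Continuous _).aestronglyMeasurable

lemma tendstoInDistribution_finset (n : ℕ)
    {Ω : ℕ → Type*} [∀ N, MeasurableSpace (Ω N)]
    (P : ∀ N, Measure (Ω N)) [∀ N, IsProbabilityMeasure (P N)]
    (U : ∀ N, Ω N → Matrix.unitaryGroup (Fin N) ℂ)
    (hU : ∀ N, IsHaarDistributed (U N) (P N))
    {Ω' : Type*} [MeasurableSpace Ω'] (P' : Measure Ω') [IsProbabilityMeasure P']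
    (G : ℕ+ → Fin n → Fin n → Ω' → ℂ)
    (hG_law : ∀ p i j, HasLaw (G p i j) stdComplexGaussian P')
    (hG_indep : iIndepFun (fun x : ℕ+ × Fin n × Fin n ↦ G x.1 x.2.1 x.2.2) P')
    (s : Finset (ℕ+ × Fin n × Fin n)) :
    TendstoInDistribution
      (fun N ω (x : s) ↦ scaledPowerEntry n (U N ω) x.1.1 x.1.2.1 x.1.2.2)
      atTop (fun ω (x : s) ↦ G x.1.1 x.1.2.1 x.1.2.2 ω) P P' := by
  have hmeas : ∀ N, AEMeasurable (fun ω ↦ WithLp.toLp 2 fun x : s ↦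
      scaledPowerEntry n (U N ω) x.1.1 x.1.2.1 x.1.2.2) (P N) := fun N ↦
    (PiLp.continuous_toLp 2 _).measurable.comp_aemeasurable (aemeasurable_pi_iff.2 fun x ↦
      (continuous_scaledPowerEntry n _ _ _).measurable.comp_aemeasurable (hU N).aemeasurable)
  have hGm : ∀ x : s, AEMeasurable (G x.1.1 x.1.2.1 x.1.2.2) P' := fun x ↦ (hG_law _ _ _).aemeasurable
  have hmeas' : AEMeasurable (fun ω ↦ WithLp.toLp 2 fun x : s ↦ G x.1.1 x.1.2.1 x.1.2.2 ω) P' :=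
    (PiLp.continuous_toLp 2 _).measurable.comp_aemeasurable (aemeasurable_pi_iff.2 hGm)
  have hind : iIndepFun (fun x : s ↦ G x.1.1 x.1.2.1 x.1.2.2) P' :=
    hG_indep.precomp Subtype.val_injective
  -- Characteristic functions need an inner product, so convergence is proved in the Euclidean space
  -- and then carried to the plain product.
  have hT : TendstoInDistribution (fun N ω ↦ WithLp.toLp 2 fun x : s ↦
      scaledPowerEntry n (U N ω) x.1.1 x.1.2.1 x.1.2.2) atTop
      (fun ω ↦ WithLp.toLp 2 fun x : s ↦ G x.1.1 x.1.2.1 x.1.2.2 ω) P P' := by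
    refine ⟨hmeas, hmeas', ProbabilityMeasure.tendsto_of_tendsto_charFun fun c ↦ ?_⟩
    simp only [ProbabilityMeasure.coe_mk]
    rw [(iIndepFun_iff_charFun_pi hGm).1 hind c]
    simp_rw [(hG_law _ _ _).map_eq, charFun_stdComplexGaussian]
    convert tendsto_charFun_scaledPowerEntry n P U hU s c using 2
    rw [← Complex.ofReal_prod, ← Real.exp_sum, ← Finset.sum_div, Finset.sum_neg_distrib]
  exact hT.continuous_comp (PiLp.continuous_ofLp 2 _)

theorem lemma4p2 (n : ℕ) (hn : 1 ≤ n)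
    {Ω : ℕ → Type*} [∀ N, MeasurableSpace (Ω N)]
    (P : ∀ N, Measure (Ω N)) [∀ N, IsProbabilityMeasure (P N)]
    (U : ∀ N, Ω N → Matrix.unitaryGroup (Fin N) ℂ)
    (hU : ∀ N, IsHaarDistributed (U N) (P N))
    {Ω' : Type*} [MeasurableSpace Ω'] (P' : Measure Ω') [IsProbabilityMeasure P']
    (G : ℕ+ → Fin n → Fin n → Ω' → ℂ)
    (hG_law : ∀ p i j, HasLaw (G p i j) stdComplexGaussian P')
    (hG_indep : iIndepFun (fun x : ℕ+ × Fin n × Fin n ↦ G x.1 x.2.1 x.2.2) P') :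
    TendstoInDistribution
      (fun N ω (p : ℕ+) (i j : Fin n) ↦ scaledPowerEntry n (U N ω) p i j)
      atTop (fun ω p i j ↦ G p i j ω) P P' ∧
    ∀ s : Finset (ℕ+ × Fin n × Fin n),
      TendstoInDistribution
        (fun N ω (x : s) ↦ scaledPowerEntry n (U N ω) x.1.1 x.1.2.1 x.1.2.2)
        atTop (fun ω (x : s) ↦ G x.1.1 x.1.2.1 x.1.2.2 ω) P P' := by
  have hfin := tendstoInDistribution_finset n P U hU P' G hG_law hG_indep
  refine ⟨?_, hfin⟩
  have hprod := tendstoInDistribution_of_forall_finset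
    (X := fun N ω (x : ℕ+ × Fin n × Fin n) ↦ scaledPowerEntry n (U N ω) x.1 x.2.1 x.2.2)
    (Z := fun ω x ↦ G x.1 x.2.1 x.2.2 ω) hfin
  -- A family indexed by triples becomes a sequence of matrices by a continuous map.
  have hcurry : Continuous fun (f : ℕ+ × Fin n × Fin n → ℂ) (p : ℕ+) (i j : Fin n) ↦
    f (p, i, j) := by fun_prop
  exact hprod.continuous_comp hcurry

end Assembly
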